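/- Let $n=2^{J_n}\ge 8$ and $0=x_1<x_2<\dots<x_n<x_{n+1}=1$. One observes $Y_i=\mu_i+\sigma\varepsilon_i$, $i=1,\dots,n$, where $\sigma>0$, the $\varepsilon_i$ are i.i.d. standard Gaussian random variables, and $\mu_i=f(x_i)$ for a function $f:[0,1]\to\mathbb R$. Write $\langle x,y\rangle_n=\frac1n\sum_{i=1}^n x_iy_i$, and $\|\cdot\|_n$ for the associated norm, $\|\cdot\|$ for the Euclidean norm. Set $\Lambda(0)=\{(0,0)\}$, $\Lambda(j)=\{j\}\times\{0,\dots,2^{j-1}-1\}$ for $j\ge1$, and $\Lambda^*=\bigcup_{j=0}^{J_n-1}\Lambda(j)$, so that $|\Lambda^*|=n/2$. Let $v_{0,0}=(1,\dots,1)'$ and, for $j\ge 1$, $[v_{j,k}]_i=2^{(j-1)/2}\big(\mathbf 1_{I^+_{j,k}}(i)-\mathbf 1_{I^-_{j,k}}(i)\big)$ with $I^+_{j,k}=\{1+(2k+1)2^{-j}n,\dots,(2k+2)2^{-j}n\}$ and $I^-_{j,k}=\{1+2k\,2^{-j}n,\dots,(2k+1)2^{-j}n\}$. For $m\subset\Lambda^*$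 let $\mathcal S_m=\mathrm{span}\{v_{j,k}:(j,k)\in m\}$, let $\hat\mu_m$ be the orthogonal projection of $Y$ onto $\mathcal S_m$, let $\hat\sigma^2=\|Y-\hat\mu_{\Lambda^*}\|^2/(n-\dim\mathcal S_{\Lambda^*})$, and, for $\beta>0$, let $$\hat\mu=\sum_{m\subset\Lambda^*}w_m\hat\mu_m,\qquad w_m=\frac{\pi_m}{\mathcal Z}\exp\Big(\beta\frac{\|\hat\mu_m\|^2}{\hat\sigma^2}-b|m|\Big),\qquad \pi_m=\Big(1+\frac1{p^{\alpha}}\Big)^{-p}p^{-\alpha|m|},$$ with $p=n/2$, $\alpha=b=1$, and $\mathcal Z$ normalizing the sum of the $w_m$ to one. Let $\phi^{-1}:\,]0,\infty[\,\to\,]0,1[$ be the inverse of $\phi(x)=(x-1-\log x)/2$, and assume that $$0<\beta\le\tfrac12\,\phi^{-1}\Big(\frac{2\log(n/2)}n\Big).$$ Then $\hat\mu$ is the shrinkage estimator $$\hat\mu=\sum_{(j,k)\in\Lambda^*}\frac{Z_{j,k}\exp(n\beta Z_{j,k}^2/\hat\sigma^2)}{en/2+\exp(n\beta Z_{j,k}^2/\hat\sigma^2)}\,v_{j,k},\qquad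 Z_{j,k}=\langle Y,v_{j,k}\rangle_n,\qquad \hat\sigma^2=2\Big(\langle Y,Y\rangle_n-\sum_{(j,k)\in\Lambda^*}Z_{j,k}^2\Big),$$ and there exists a numerical constant $C$ (independent of $n$, $\beta$, $x_1,\dots,x_n$, $\sigma$ and $f$) such that, for any function $f$ with finite total variation $V(f)$ on $[0,1]$, $$\mathbb E\,\|\mu-\hat\mu\|_n^2\ \le\ \frac C\beta\,\max\Big\{\Big(\frac{V(f)\sigma^2\log n}{n}\Big)^{2/3},\ \frac{V(f)^2}{n},\ \frac{\sigma^2\log n}{n}\Big\}.$$ -/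

import Mathlib

open MeasureTheory ProbabilityTheory

noncomputable section

namespace HaarMix

/-- The function `φ(x) = (x - 1 - log x) / 2`, considered on `]0,1[`. -/
def phi (x : ℝ) : ℝ := (x - 1 - Real.log x) / 2

/-- `φ` is a bijection from `]0,1[` onto `]0,∞[`, so that its inverse is well defined there. -/
theorem phi_bijOn : Set.BijOn phi (Set.Ioo 0 1) (Set.Ioi 0) := by
  refine ⟨?_, ?_, ?_⟩
  · rintro x ⟨h0, h1⟩
    have := Real.log_lt_sub_one_of_pos h0 h1.ne
    simp only [phi, Set.mem_Ioi]
    linarith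
  · have key : ∀ x ∈ Set.Ioo (0 : ℝ) 1, ∀ y ∈ Set.Ioo (0 : ℝ) 1, x < y → phi x ≠ phi y := by
      rintro x ⟨hx0, hx1⟩ y ⟨hy0, hy1⟩ hxy h
      have hne : x / y ≠ 1 := by
        rw [ne_eq, div_eq_one_iff_eq hy0.ne']
        exact hxy.ne
      have h1 := Real.log_lt_sub_one_of_pos (div_pos hx0 hy0) hne
      rw [Real.log_div hx0.ne' hy0.ne'] at h1
      have h2 : x / y - 1 ≤ x - y := by
        rw [div_sub_one hy0.ne', div_le_iff₀ hy0]
        nlinarith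
      simp only [phi] at h
      linarith
    intro x hx y hy h
    rcases lt_trichotomy x y with hlt | heq | hgt
    · exact absurd h (key x hx y hy hlt)
    · exact heq
    · exact absurd h.symm (key y hy x hx hgt)
  · intro y hy
    have hy' : 0 < y := hy
    have ha : (0 : ℝ) < Real.exp (-(2 * y + 1)) := Real.exp_pos _
    have ha1 : Real.exp (-(2 * y + 1)) ≤ 1 := Real.exp_le_one_iff.2 (by linarith)
    have hc : ContinuousOn phi (Set.Icc (Real.exp (-(2 * y + 1))) 1) := by
      unfold phi
      refine ContinuousOn.div_const (ContinuousOn.sub (by fun_prop) ?_) _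
      exact Real.continuousOn_log.mono fun x hx => (ha.trans_le hx.1).ne'
    have hmem : y ∈ Set.Icc (phi 1) (phi (Real.exp (-(2 * y + 1)))) := by
      simp only [phi, Real.log_one, Real.log_exp, Set.mem_Icc]
      constructor <;> linarith
    obtain ⟨x, hx, hxy⟩ := intermediate_value_Icc' ha1 hc hmem
    refine ⟨x, ⟨ha.trans_le hx.1, lt_of_le_of_ne hx.2 ?_⟩, hxy⟩
    rintro rfl
    simp [phi] at hxy
    exact hy'.ne hxy

/-- The inverse `φ⁻¹ : ]0,∞[ → ]0,1[` of `φ` (used at positive arguments only). -/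
def phiInv (y : ℝ) : ℝ := Function.invFunOn phi (Set.Ioo 0 1) y

/-! ### The mixing procedure on all the subsets of a finite family of vectors -/

section Mixing

variable {n : ℕ} {ι : Type*}

/-- The model `S_m = span {v_j : j ∈ m}`. -/
def model (v : ι → EuclideanSpace ℝ (Fin n)) (m : Finset ι) :
    Submodule ℝ (EuclideanSpace ℝ (Fin n)) :=
  Submodule.span ℝ (v '' (m : Set ι))

/-- The least-squares estimator `Π_{S_m} y` on the model `S_m`. -/
def leastSquares (v : ι → EuclideanSpace ℝ (Fin n)) (m : Finset ι)
    (y : EuclideanSpace ℝ (Fin n)) : EuclideanSpace ℝ (Fin n) :=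
  (model v m).starProjection y

/-- The residual variance estimator `‖y - Π_{S_*} y‖² / (n - dim S_*)`, where `S_*` is the largest
model `S_Λ`. -/
def residualVariance (v : ι → EuclideanSpace ℝ (Fin n)) (Λ : Finset ι)
    (y : EuclideanSpace ℝ (Fin n)) : ℝ :=
  ‖y - leastSquares v Λ y‖ ^ 2 / ((n : ℝ) - (Module.finrank ℝ (model v Λ) : ℝ))

/-- The prior `π_m = (1 + p^{-α})^{-p} p^{-α |m|}` on the subsets of a set with `p` elements. -/
def prior (p : ℕ) (α : ℝ) (m : Finset ι) : ℝ :=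
  ((1 + 1 / (p : ℝ) ^ α) ^ p)⁻¹ * (p : ℝ) ^ (-α * (m.card : ℝ))

/-- The unnormalized weight `π_m exp (β ‖Π_{S_m} y‖² / σ̂² - L_m)` with `L_m = b |m|`. -/
def rawWeight (v : ι → EuclideanSpace ℝ (Fin n)) (Λ : Finset ι) (α b β : ℝ)
    (y : EuclideanSpace ℝ (Fin n)) (m : Finset ι) : ℝ :=
  prior Λ.card α m *
    Real.exp (β * (‖leastSquares v m y‖ ^ 2 / residualVariance v Λ y) - b * (m.card : ℝ))

/-- The mixing estimator `∑_m w_m Π_{S_m} y`, where `m` runs over all the subsets of `Λ` and the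
`w_m` are the weights `rawWeight`, normalized to have sum one. -/
def mixingEstimator (v : ι → EuclideanSpace ℝ (Fin n)) (Λ : Finset ι) (α b β : ℝ)
    (y : EuclideanSpace ℝ (Fin n)) : EuclideanSpace ℝ (Fin n) :=
  ∑ m ∈ Λ.powerset,
    (rawWeight v Λ α b β y m / ∑ m' ∈ Λ.powerset, rawWeight v Λ α b β y m') •
      leastSquares v m y

/-- The scalar product `⟨u, w⟩_n = (1/n) ∑ u_i w_i`. -/
def empInner (u w : EuclideanSpace ℝ (Fin n)) : ℝ := (1 / (n : ℝ)) * ∑ i, u i * w i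

end Mixing

/-! ### The Haar family for `n = 2 ^ J` -/

/-- `Λ(0) = {(0,0)}` and `Λ(j) = {j} × {0, …, 2^{j-1} - 1}` for `j ≥ 1`. -/
def haarLevel (j : ℕ) : Finset (ℕ × ℕ) :=
  if j = 0 then {(0, 0)} else {j} ×ˢ Finset.range (2 ^ (j - 1))

/-- `Λ^* = ⋃_{0 ≤ j ≤ J - 1} Λ(j)`. -/
def haarIndex (J : ℕ) : Finset (ℕ × ℕ) := (Finset.range J).biUnion haarLevel

/-- `I⁺_{j,k} = {1 + (2k+1) 2^{-j} n, …, (2k+2) 2^{-j} n}`, for `n = 2 ^ J` and `j ≤ J`. -/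
def haarPos (J j k : ℕ) : Finset ℕ :=
  Finset.Icc (1 + (2 * k + 1) * 2 ^ (J - j)) ((2 * k + 2) * 2 ^ (J - j))

/-- `I⁻_{j,k} = {1 + 2k 2^{-j} n, …, (2k+1) 2^{-j} n}`, for `n = 2 ^ J` and `j ≤ J`. -/
def haarNeg (J j k : ℕ) : Finset ℕ :=
  Finset.Icc (1 + 2 * k * 2 ^ (J - j)) ((2 * k + 1) * 2 ^ (J - j))

/-- The Haar vectors: `v_{0,0}` is the constant vector `1`, and
`[v_{j,k}]_i = 2^{(j-1)/2} (1_{I⁺_{j,k}}(i) - 1_{I⁻_{j,k}}(i))` for `j ≥ 1`. The coordinates are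
numbered from `1` in the formula and from `0` in `Fin (2 ^ J)`. -/
def haarVec (J : ℕ) (jk : ℕ × ℕ) : EuclideanSpace ℝ (Fin (2 ^ J)) :=
  WithLp.toLp 2 fun i =>
    if jk.1 = 0 then 1
    else (2 : ℝ) ^ (((jk.1 : ℝ) - 1) / 2) *
      ((if (i : ℕ) + 1 ∈ haarPos J jk.1 jk.2 then 1 else 0) -
        (if (i : ℕ) + 1 ∈ haarNeg J jk.1 jk.2 then 1 else 0))

/-- The estimator `μ̂`: mixing over the models spanned by the subfamilies of
`{v_{j,k} : (j,k) ∈ Λ^*}`, with `α = b = 1`. -/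
def haarEstimator (J : ℕ) (β : ℝ) (y : EuclideanSpace ℝ (Fin (2 ^ J))) :
    EuclideanSpace ℝ (Fin (2 ^ J)) :=
  mixingEstimator (haarVec J) (haarIndex J) 1 1 β y

/-- `σ̂² = 2 (⟨y, y⟩_n - ∑ Z_{j,k}²)` with `Z_{j,k} = ⟨y, v_{j,k}⟩_n`. -/
def haarVariance (J : ℕ) (y : EuclideanSpace ℝ (Fin (2 ^ J))) : ℝ :=
  2 * (empInner y y - ∑ jk ∈ haarIndex J, empInner y (haarVec J jk) ^ 2)

/-- The shrinkage estimator
`∑ (Z_{j,k} exp (n β Z_{j,k}² / σ̂²) / (e n / 2 + exp (n β Z_{j,k}² / σ̂²))) v_{j,k}`. -/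
def haarShrinkage (J : ℕ) (β : ℝ) (y : EuclideanSpace ℝ (Fin (2 ^ J))) :
    EuclideanSpace ℝ (Fin (2 ^ J)) :=
  ∑ jk ∈ haarIndex J,
    (empInner y (haarVec J jk) *
        Real.exp (2 ^ J * β * empInner y (haarVec J jk) ^ 2 / haarVariance J y) /
      (Real.exp 1 * 2 ^ J / 2 +
        Real.exp (2 ^ J * β * empInner y (haarVec J jk) ^ 2 / haarVariance J y))) •
      haarVec J jk

/-- The vector `μ = (f(x_1), …, f(x_n))` for the design `0 = x_1 < ⋯ < x_n < x_{n+1} = 1`. -/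
def signal {n : ℕ} (f : ℝ → ℝ) (x : Fin (n + 1) → ℝ) : EuclideanSpace ℝ (Fin n) :=
  WithLp.toLp 2 fun i => f (x i.castSucc)

/-- The observations `Y_i = μ_i + σ ε_i`. -/
def observation {n : ℕ} {Ω : Type*} (μ : EuclideanSpace ℝ (Fin n)) (σ : ℝ)
    (ε : Fin n → Ω → ℝ) (ω : Ω) : EuclideanSpace ℝ (Fin n) :=
  WithLp.toLp 2 fun i => μ i + σ * ε i ω

/-- The squared loss `‖μ - μ̂‖²_n` of the estimator `μ̂` computed from the observations `y`. -/
def haarLoss (J : ℕ) (β : ℝ) (μ y : EuclideanSpace ℝ (Fin (2 ^ J))) : ℝ :=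
  empInner (μ - haarEstimator J β y) (μ - haarEstimator J β y)

/-- The total variation `V(f)` of `f` on `[0,1]`. -/
def totalVariation (f : ℝ → ℝ) : ℝ := (eVariationOn f (Set.Icc 0 1)).toReal

end HaarMix

end

/-! The Haar vectors are orthonormal for `empInner`, so `‖Π_m y‖²` is a sum over `m` and the weight
of `m` is, up to a constant, a product over its elements. Averaging over all subsets then acts on
each coefficient separately, multiplying it by `q / (1 + q)`; this is the shrinkage form
(`EmpOrthonormal.mixingEstimator_eq`).

The level `J`, left out of the mixing, completes the basis, and `σ̂²` is twice the energy of the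
data on it (`haarVariance_eq_sum`). An orthonormal change of basis keeps the noise independent, so
`σ̂²` is independent of every coefficient to be shrunk, and the problem becomes a Gaussian sequence
model with noise level `σ/√n`.

For one coordinate `θ` the risk is bounded by a constant times `min D θ²`, plus a remainder of order
`σ² log n / n²`, where `D` is of order `(σ² + V²/n) log n / (nβ)` (`integral_coordinate_risk_le`).
The bound by `D` holds because shrinkage moves an observation by at most about the random threshold.
The bound by `θ²` holds because, when `σ̂² > 2βσ²`, the threshold lies above the universal one and
pure noise is almost killed. The condition on `β` is exactly what makes the complementary event have
probability at most `2/n`, through a chi-square lower tail.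

Bounded variation bounds the `ℓ¹` norm of the coefficients at level `j` by `V 2^{-j/2}`. Hence level
`j` contributes at most `min (2^j D) (V √D 2^{-j/2})`, and two geometric sums on either side of the
crossing `2^j = (V²/D)^{1/3}` give `(V D)^{2/3}`. The level `J` is pure bias, at most `V²/n`. -/

noncomputable section

namespace HaarMix

/-! ### Least squares and mixing over an orthonormal family. -/

section Mixing

variable {n : ℕ} {ι : Type*}

theorem empInner_eq (u w : EuclideanSpace ℝ (Fin n)) : empInner u w = inner ℝ u w / n := by
  simp only [empInner, PiLp.inner_apply, RCLike.inner_apply, conj_trivial]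
  rw [one_div, div_eq_inv_mul _ (n : ℝ)]
  congr 1
  exact Finset.sum_congr rfl fun i _ => mul_comm _ _

/-- The family `v`, restricted to `Λ`, is orthonormal for `⟨·,·⟩_n`. -/
def EmpOrthonormal (v : ι → EuclideanSpace ℝ (Fin n)) (Λ : Finset ι) : Prop :=
  (∀ a ∈ Λ, empInner (v a) (v a) = 1) ∧ ∀ a ∈ Λ, ∀ b ∈ Λ, a ≠ b → empInner (v a) (v b) = 0

theorem EmpOrthonormal.mono {v : ι → EuclideanSpace ℝ (Fin n)} {Λ m : Finset ι}
    (h : EmpOrthonormal v Λ) (hm : m ⊆ Λ) : EmpOrthonormal v m :=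
  ⟨fun a ha => h.1 a (hm ha), fun a ha b hb => h.2 a (hm ha) b (hm hb)⟩

theorem empInner_comm (u w : EuclideanSpace ℝ (Fin n)) : empInner u w = empInner w u := by
  rw [empInner_eq, empInner_eq, real_inner_comm]

theorem empInner_sub_left (u u' w : EuclideanSpace ℝ (Fin n)) :
    empInner (u - u') w = empInner u w - empInner u' w := by
  simp only [empInner_eq, inner_sub_left, sub_div]

theorem empInner_smul_left (c : ℝ) (u w : EuclideanSpace ℝ (Fin n)) :
    empInner (c • u) w = c * empInner u w := by
  simp only [empInner_eq, real_inner_smul_left, mul_div_assoc]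

theorem empInner_sum_left (s : Finset ι) (u : ι → EuclideanSpace ℝ (Fin n))
    (w : EuclideanSpace ℝ (Fin n)) : empInner (∑ a ∈ s, u a) w = ∑ a ∈ s, empInner (u a) w := by
  simp only [empInner_eq, sum_inner, Finset.sum_div]

theorem norm_sq_eq_empInner (hn : 0 < n) (u : EuclideanSpace ℝ (Fin n)) :
    ‖u‖ ^ 2 = n * empInner u u := by
  have : (n : ℝ) ≠ 0 := by positivity
  rw [empInner_eq, real_inner_self_eq_norm_sq]
  field_simp

theorem EmpOrthonormal.empInner_sum {v : ι → EuclideanSpace ℝ (Fin n)} {Λ : Finset ι}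
    (h : EmpOrthonormal v Λ) (c : ι → ℝ) {b : ι} (hb : b ∈ Λ) :
    empInner (∑ a ∈ Λ, c a • v a) (v b) = c b := by
  rw [empInner_sum_left, Finset.sum_eq_single_of_mem b hb]
  · rw [empInner_smul_left, h.1 b hb, mul_one]
  · intro a ha hab
    rw [empInner_smul_left, h.2 a ha b hb hab, mul_zero]

theorem EmpOrthonormal.empInner_sum_self {v : ι → EuclideanSpace ℝ (Fin n)} {Λ : Finset ι}
    (h : EmpOrthonormal v Λ) (c : ι → ℝ) :
    empInner (∑ a ∈ Λ, c a • v a) (∑ a ∈ Λ, c a • v a) = ∑ a ∈ Λ, c a ^ 2 := by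
  rw [empInner_sum_left]
  refine Finset.sum_congr rfl fun a ha => ?_
  rw [empInner_smul_left, empInner_comm, h.empInner_sum c ha, sq]

theorem EmpOrthonormal.leastSquares_eq (hn : 0 < n) {v : ι → EuclideanSpace ℝ (Fin n)}
    {m : Finset ι} (h : EmpOrthonormal v m) (y : EuclideanSpace ℝ (Fin n)) :
    leastSquares v m y = ∑ a ∈ m, empInner y (v a) • v a := by
  have hn' : (n : ℝ) ≠ 0 := by positivity
  refine Submodule.eq_starProjection_of_mem_of_inner_eq_zero ?_ ?_
  · exact Submodule.sum_mem _ fun a ha =>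
      Submodule.smul_mem _ _ (Submodule.subset_span ⟨a, ha, rfl⟩)
  · intro w hw
    induction hw using Submodule.span_induction with
    | mem x hx =>
      obtain ⟨a, ha, rfl⟩ := hx
      have : empInner (y - ∑ a ∈ m, empInner y (v a) • v a) (v a) = 0 := by
        rw [empInner_sub_left, h.empInner_sum _ ha, sub_self]
      rw [empInner_eq, div_eq_zero_iff] at this
      exact this.resolve_right hn'
    | zero => simp
    | add x y _ _ hx hy => rw [inner_add_right, hx, hy, add_zero]
    | smul c x _ hx => rw [real_inner_smul_right, hx, mul_zero]

theorem EmpOrthonormal.norm_sq_leastSquares (hn : 0 < n) {v : ι → EuclideanSpace ℝ (Fin n)}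
    {m : Finset ι} (h : EmpOrthonormal v m) (y : EuclideanSpace ℝ (Fin n)) :
    ‖leastSquares v m y‖ ^ 2 = n * ∑ a ∈ m, empInner y (v a) ^ 2 := by
  rw [norm_sq_eq_empInner hn, h.leastSquares_eq hn, h.empInner_sum_self]

theorem EmpOrthonormal.linearIndependent (hn : 0 < n) {v : ι → EuclideanSpace ℝ (Fin n)}
    {m : Finset ι} (h : EmpOrthonormal v m) :
    LinearIndependent ℝ fun a : m => v a := by
  have hn' : (n : ℝ) ≠ 0 := by positivity
  refine linearIndependent_of_ne_zero_of_inner_eq_zero ?_ ?_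
  · rintro ⟨a, ha⟩ h0
    have := h.1 a ha
    simp only at h0
    rw [h0, empInner_eq, inner_zero_left, zero_div] at this
    exact zero_ne_one this
  · rintro ⟨a, ha⟩ ⟨b, hb⟩ hab
    have := h.2 a ha b hb fun e => hab (Subtype.ext e)
    rw [empInner_eq, div_eq_zero_iff] at this
    exact this.resolve_right hn'

theorem EmpOrthonormal.finrank_model (hn : 0 < n) {v : ι → EuclideanSpace ℝ (Fin n)}
    {m : Finset ι} (h : EmpOrthonormal v m) :
    Module.finrank ℝ (model v m) = m.card := by
  have := finrank_span_eq_card (h.linearIndependent hn)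
  rw [Fintype.card_coe] at this
  rw [← this, model, Set.image_eq_range]
  rfl

theorem EmpOrthonormal.residualVariance_eq (hn : 0 < n) {v : ι → EuclideanSpace ℝ (Fin n)}
    {m : Finset ι} (h : EmpOrthonormal v m) (y : EuclideanSpace ℝ (Fin n)) :
    residualVariance v m y =
      n * (empInner y y - ∑ a ∈ m, empInner y (v a) ^ 2) / (n - m.card) := by
  rw [residualVariance, h.finrank_model hn, norm_sq_eq_empInner hn, h.leastSquares_eq hn]
  congr 2
  set w := ∑ a ∈ m, empInner y (v a) • v a with hw
  have h1 : empInner w w = ∑ a ∈ m, empInner y (v a) ^ 2 := h.empInner_sum_self _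
  have h2 : empInner w y = ∑ a ∈ m, empInner y (v a) ^ 2 := by
    rw [hw, empInner_sum_left]
    refine Finset.sum_congr rfl fun a _ => ?_
    rw [empInner_smul_left, empInner_comm (v a), sq]
  rw [empInner_sub_left, empInner_comm y (y - w), empInner_comm w (y - w), empInner_sub_left,
    empInner_sub_left, empInner_comm y w, h1, h2]
  ring

/-- Averages of linear statistics under a product weight on the subsets of `Λ` factorize. -/
theorem sum_powerset_prod_smul_sum [DecidableEq ι] {E : Type*} [AddCommGroup E] [Module ℝ E]
    (Λ : Finset ι) (q : ι → ℝ) (hq : ∀ a ∈ Λ, 0 < q a) (u : ι → E) :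
    ∑ m ∈ Λ.powerset, (∏ a ∈ m, q a) • ∑ a ∈ m, u a =
      (∏ a ∈ Λ, (1 + q a)) • ∑ a ∈ Λ, (q a / (1 + q a)) • u a := by
  induction Λ using Finset.induction_on with
  | empty => simp
  | insert b s hb ih =>
    have hqb : (1 + q b) ≠ 0 := by
      have := hq b (Finset.mem_insert_self _ _)
      positivity
    rw [Finset.sum_powerset_insert hb, Finset.sum_insert hb, Finset.prod_insert hb,
      ih fun a ha => hq a (Finset.mem_insert_of_mem ha)]
    have h1 : ∀ t ∈ s.powerset, (∏ a ∈ insert b t, q a) • ∑ a ∈ insert b t, u a =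
        (q b * ∏ a ∈ t, q a) • u b + q b • ((∏ a ∈ t, q a) • ∑ a ∈ t, u a) := by
      intro t ht
      have hbt : b ∉ t := fun h => hb (Finset.mem_powerset.1 ht h)
      rw [Finset.prod_insert hbt, Finset.sum_insert hbt, smul_add, smul_smul]
    rw [Finset.sum_congr rfl h1, Finset.sum_add_distrib, ← Finset.smul_sum,
      ih fun a ha => hq a (Finset.mem_insert_of_mem ha), ← Finset.sum_smul, ← Finset.mul_sum,
      ← Finset.prod_one_add]
    have h2 : (1 + q b) * (∏ a ∈ s, (1 + q a)) * (q b / (1 + q b)) =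
        q b * ∏ a ∈ s, (1 + q a) := by field_simp
    rw [smul_add, smul_smul _ _ (u b), h2]
    module

/-- Each index `a ∈ m` brings `exp (nβ Z_a² / σ̂²)` from the projection, `1/p` from the prior and
`1/e` from the penalty. Their product `q a` is the odds that `a` is selected, and these selections
are independent under the normalized weights. -/
theorem EmpOrthonormal.mixingEstimator_eq [DecidableEq ι] (hn : 0 < n)
    {v : ι → EuclideanSpace ℝ (Fin n)}
    {Λ : Finset ι} (h : EmpOrthonormal v Λ) (hΛ : 0 < Λ.card) (β : ℝ)
    (y : EuclideanSpace ℝ (Fin n)) :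
    mixingEstimator v Λ 1 1 β y = ∑ a ∈ Λ,
      (empInner y (v a) * Real.exp (n * β * empInner y (v a) ^ 2 / residualVariance v Λ y) /
        (Real.exp 1 * Λ.card +
          Real.exp (n * β * empInner y (v a) ^ 2 / residualVariance v Λ y))) • v a := by
  set s := residualVariance v Λ y with hs
  set G : ι → ℝ := fun a => Real.exp (n * β * empInner y (v a) ^ 2 / s) with hG
  have hp : (0 : ℝ) < Λ.card := by exact_mod_cast hΛ
  set q : ι → ℝ := fun a => G a / (Real.exp 1 * Λ.card) with hq
  have hqpos : ∀ a, 0 < q a := fun a => by positivity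
  set c : ℝ := ((1 + 1 / (Λ.card : ℝ) ^ (1 : ℝ)) ^ Λ.card)⁻¹ with hc
  have hcpos : 0 < c := by positivity
  have hw : ∀ m ∈ Λ.powerset, rawWeight v Λ 1 1 β y m = c * ∏ a ∈ m, q a := by
    intro m hm
    rw [rawWeight, prior, mul_assoc, (h.mono (Finset.mem_powerset.1 hm)).norm_sq_leastSquares hn]
    congr 1
    rw [hq, Finset.prod_div_distrib, hG, ← Real.exp_sum, Finset.prod_const, mul_pow,
      neg_one_mul, Real.rpow_neg hp.le, Real.rpow_natCast, one_mul, Real.exp_sub,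
      ← Finset.sum_div, ← Finset.mul_sum, ← Real.exp_nat_mul, mul_one]
    rw [← hs, show β * ((n * ∑ a ∈ m, empInner y (v a) ^ 2) / s) =
      (n * β * ∑ a ∈ m, empInner y (v a) ^ 2) / s by ring]
    field_simp
  have hsum : ∑ m ∈ Λ.powerset, rawWeight v Λ 1 1 β y m = c * ∏ a ∈ Λ, (1 + q a) := by
    rw [Finset.sum_congr rfl hw, ← Finset.mul_sum, Finset.prod_one_add]
  have hP : 0 < ∏ a ∈ Λ, (1 + q a) := Finset.prod_pos fun a _ => by linarith [hqpos a]
  rw [mixingEstimator, hsum]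
  have h1 : ∀ m ∈ Λ.powerset,
      (rawWeight v Λ 1 1 β y m / (c * ∏ a ∈ Λ, (1 + q a))) • leastSquares v m y =
      (∏ a ∈ Λ, (1 + q a))⁻¹ • ((∏ a ∈ m, q a) • ∑ a ∈ m, empInner y (v a) • v a) := by
    intro m hm
    rw [hw m hm, (h.mono (Finset.mem_powerset.1 hm)).leastSquares_eq hn, smul_smul]
    congr 1
    field_simp
  rw [Finset.sum_congr rfl h1, ← Finset.smul_sum,
    sum_powerset_prod_smul_sum Λ q (fun a _ => hqpos a), smul_smul, inv_mul_cancel₀ hP.ne',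
    one_smul]
  refine Finset.sum_congr rfl fun a _ => ?_
  rw [smul_smul]
  congr 1
  have : 0 < G a := Real.exp_pos _
  have h3 : Real.exp 1 * Λ.card + G a ≠ 0 := by positivity
  change q a / (1 + q a) * empInner y (v a) = empInner y (v a) * G a / (Real.exp 1 * Λ.card + G a)
  simp only [hq]
  field_simp

end Mixing

/-! ### Expansion in a full orthonormal basis. -/

section Mixing

variable {n : ℕ} {ι : Type*}

theorem EmpOrthonormal.eq_sum (hn : 0 < n) {v : ι → EuclideanSpace ℝ (Fin n)} {Λ : Finset ι}
    (h : EmpOrthonormal v Λ) (hc : Λ.card = n) (y : EuclideanSpace ℝ (Fin n)) :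
    y = ∑ a ∈ Λ, empInner y (v a) • v a := by
  have htop : model v Λ = ⊤ := by
    apply Submodule.eq_top_of_finrank_eq
    rw [h.finrank_model hn, hc, finrank_euclideanSpace_fin]
  rw [← h.leastSquares_eq hn, leastSquares]
  exact (Submodule.starProjection_eq_self_iff.2 (htop ▸ Submodule.mem_top)).symm

theorem EmpOrthonormal.parseval (hn : 0 < n) {v : ι → EuclideanSpace ℝ (Fin n)} {Λ : Finset ι}
    (h : EmpOrthonormal v Λ) (hc : Λ.card = n) (y : EuclideanSpace ℝ (Fin n)) :
    empInner y y = ∑ a ∈ Λ, empInner y (v a) ^ 2 := by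
  conv_lhs => rw [h.eq_sum hn hc y]
  exact h.empInner_sum_self _

end Mixing

/-! ### The Haar basis and the explicit form of the estimator. -/

section Haar

theorem mem_haarIndex {J j k : ℕ} :
    (j, k) ∈ haarIndex J ↔ j < J ∧ (if j = 0 then k = 0 else k < 2 ^ (j - 1)) := by
  simp only [haarIndex, Finset.mem_biUnion, Finset.mem_range, haarLevel]
  constructor
  · rintro ⟨i, hi, h⟩
    split_ifs at h with h0
    · simp only [Finset.mem_singleton, Prod.mk.injEq] at h
      rw [if_pos h.1]
      exact ⟨by omega, h.2⟩
    · simp only [Finset.mem_product, Finset.mem_singleton, Finset.mem_range] at h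
      obtain ⟨rfl, h⟩ := h
      rw [if_neg h0]
      exact ⟨hi, h⟩
  · rintro ⟨hj, h⟩
    refine ⟨j, hj, ?_⟩
    split_ifs at h ⊢ with h0
    · simp [h0, h]
    · simpa using h

theorem haarIndex_succ (J : ℕ) : haarIndex (J + 1) = haarLevel J ∪ haarIndex J := by
  rw [haarIndex, Finset.range_add_one, Finset.biUnion_insert, haarIndex]

theorem fst_eq_of_mem_haarLevel {J : ℕ} {a : ℕ × ℕ} (h : a ∈ haarLevel J) : a.1 = J := by
  rw [haarLevel] at h
  split_ifs at h with h0
  · simp_all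
  · simp only [Finset.mem_product, Finset.mem_singleton] at h
    exact h.1

theorem fst_lt_of_mem_haarIndex {J : ℕ} {a : ℕ × ℕ} (h : a ∈ haarIndex J) : a.1 < J :=
  (mem_haarIndex (j := a.1) (k := a.2).1 h).1

theorem disjoint_haarLevel_haarIndex (J : ℕ) : Disjoint (haarLevel J) (haarIndex J) :=
  Finset.disjoint_left.2 fun _ h h' =>
    (fst_lt_of_mem_haarIndex h').ne (fst_eq_of_mem_haarLevel h)

theorem card_haarLevel_succ (J : ℕ) : (haarLevel (J + 1)).card = 2 ^ J := by
  simp [haarLevel]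

/-- With `J + 1` in place of `J` the index set also contains level `J` and has as many elements as
the space has dimensions, so `haarVec J` on it is a basis. -/
theorem card_haarIndex_succ (J : ℕ) : (haarIndex (J + 1)).card = 2 ^ J := by
  induction J with
  | zero => simp [haarIndex, haarLevel]
  | succ J ih =>
    rw [haarIndex_succ, Finset.card_union_of_disjoint (disjoint_haarLevel_haarIndex _), ih,
      card_haarLevel_succ]
    ring

theorem haarIndex_subset_succ (J : ℕ) : haarIndex J ⊆ haarIndex (J + 1) := by
  rw [haarIndex_succ]
  exact Finset.subset_union_right

theorem haarLevel_subset_succ (J : ℕ) : haarLevel J ⊆ haarIndex (J + 1) := by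
  rw [haarIndex_succ]
  exact Finset.subset_union_left

theorem div_eq_iff_mem_Ico {i d q : ℕ} (hd : 0 < d) : i / d = q ↔ q * d ≤ i ∧ i < (q + 1) * d := by
  rw [← Nat.le_div_iff_mul_le hd, ← Nat.div_lt_iff_lt_mul hd]
  omega

/-- Division by `2 ^ (J - j)` numbers the dyadic blocks from `0`. The positive halves are the odd
blocks and the negative halves the even ones. -/
theorem mem_haarPos {J j k i : ℕ} : i + 1 ∈ haarPos J j k ↔ i / 2 ^ (J - j) = 2 * k + 1 := by
  rw [div_eq_iff_mem_Ico (by positivity), haarPos, Finset.mem_Icc]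
  rw [show 2 * k + 1 + 1 = 2 * k + 2 by ring]
  omega

theorem mem_haarNeg {J j k i : ℕ} : i + 1 ∈ haarNeg J j k ↔ i / 2 ^ (J - j) = 2 * k := by
  rw [div_eq_iff_mem_Ico (by positivity), haarNeg, Finset.mem_Icc]
  omega

/-- The coordinates of `haarVec J (j, k)`, as a function on `ℕ`. -/
def haarFun (J j k i : ℕ) : ℝ :=
  if j = 0 then 1
  else (2 : ℝ) ^ (((j : ℝ) - 1) / 2) *
    ((if i / 2 ^ (J - j) = 2 * k + 1 then 1 else 0) - (if i / 2 ^ (J - j) = 2 * k then 1 else 0))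

theorem haarVec_apply (J j k : ℕ) (i : Fin (2 ^ J)) : haarVec J (j, k) i = haarFun J j k i := by
  simp only [haarVec, haarFun, mem_haarPos, mem_haarNeg]

theorem sum_fin_ite_div_eq {J d q : ℕ} (hd : d ≤ J) (hq : q < 2 ^ (J - d)) (F : ℕ → ℝ) :
    ∑ i : Fin (2 ^ J), (if (i : ℕ) / 2 ^ d = q then F i else 0) =
      ∑ r ∈ Finset.range (2 ^ d), F (q * 2 ^ d + r) := by
  rw [Fin.sum_univ_eq_sum_range (fun i => if i / 2 ^ d = q then F i else 0), ← Finset.sum_filter]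
  have : (Finset.range (2 ^ J)).filter (fun i => i / 2 ^ d = q) =
      Finset.Ico (q * 2 ^ d) ((q + 1) * 2 ^ d) := by
    ext i
    rw [Finset.mem_filter, Finset.mem_range, Finset.mem_Ico, div_eq_iff_mem_Ico (by positivity)]
    have h1 : (q + 1) * 2 ^ d ≤ 2 ^ (J - d) * 2 ^ d := Nat.mul_le_mul_right _ hq
    rw [← pow_add, Nat.sub_add_cancel hd] at h1
    constructor
    · exact fun h => h.2
    · exact fun h => ⟨h.2.trans_le h1, h⟩
  rw [this, Finset.sum_Ico_eq_sum_range]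
  congr 2
  rw [add_mul, one_mul, Nat.add_sub_cancel_left]

/-- Matching the two halves of the support point by point turns the coefficient into a sum of
increments. This form yields both the orthogonality and the bound by the total variation. -/
theorem empInner_haarVec {J j k : ℕ} (h0 : j ≠ 0) (hj : j ≤ J) (hk : k < 2 ^ (j - 1))
    (u : EuclideanSpace ℝ (Fin (2 ^ J))) (F : ℕ → ℝ) (hF : ∀ i, u i = F i) :
    empInner u (haarVec J (j, k)) = (2 : ℝ) ^ (((j : ℝ) - 1) / 2) / 2 ^ J *
      ∑ r ∈ Finset.range (2 ^ (J - j)),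
        (F ((2 * k + 1) * 2 ^ (J - j) + r) - F (2 * k * 2 ^ (J - j) + r)) := by
  have hk2 : 2 * k + 1 < 2 ^ (J - (J - j)) := by
    rw [Nat.sub_sub_self hj, ← Nat.sub_add_cancel (Nat.one_le_iff_ne_zero.2 h0), pow_succ]
    omega
  rw [Finset.sum_sub_distrib, ← sum_fin_ite_div_eq (Nat.sub_le _ _) hk2,
    ← sum_fin_ite_div_eq (Nat.sub_le _ _) (by omega : 2 * k < _), ← Finset.sum_sub_distrib,
    empInner, Finset.mul_sum, Finset.mul_sum]
  push_cast
  refine Finset.sum_congr rfl fun i _ => ?_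
  rw [haarVec_apply, hF, haarFun, if_neg h0]
  split_ifs <;> ring

theorem rpow_half_sq {j : ℕ} (h0 : j ≠ 0) :
    ((2 : ℝ) ^ (((j : ℝ) - 1) / 2)) ^ 2 = 2 ^ (j - 1) := by
  rw [← Real.rpow_natCast, ← Real.rpow_mul (by norm_num), ← Real.rpow_natCast]
  congr 1
  rw [Nat.cast_sub (Nat.one_le_iff_ne_zero.2 h0)]
  push_cast
  ring

theorem haarVec_empInner_self {J j k : ℕ} (h : (j, k) ∈ haarIndex (J + 1)) :
    empInner (haarVec J (j, k)) (haarVec J (j, k)) = 1 := by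
  rw [mem_haarIndex] at h
  obtain ⟨hj, h⟩ := h
  split_ifs at h with h0
  · subst h0
    simp [empInner, haarVec_apply, haarFun]
  · rw [empInner_haarVec h0 (by omega) h _ _ (haarVec_apply J j k)]
    have hd : 0 < 2 ^ (J - j) := by positivity
    rw [Finset.sum_congr rfl (g := fun _ => 2 * (2 : ℝ) ^ (((j : ℝ) - 1) / 2))]
    · rw [Finset.sum_const, Finset.card_range, nsmul_eq_mul]
      push_cast
      rw [show (2 : ℝ) ^ (((j : ℝ) - 1) / 2) / 2 ^ J *
        (2 ^ (J - j) * (2 * (2 : ℝ) ^ (((j : ℝ) - 1) / 2))) =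
        ((2 : ℝ) ^ (((j : ℝ) - 1) / 2)) ^ 2 * 2 * 2 ^ (J - j) / 2 ^ J by ring, rpow_half_sq h0,
        ← pow_succ, ← pow_add, show j - 1 + 1 + (J - j) = J by omega]
      exact div_self (by positivity)
    · intro r hr
      have hr' : r / 2 ^ (J - j) = 0 := Nat.div_eq_of_lt (Finset.mem_range.1 hr)
      have h1 : ((2 * k + 1) * 2 ^ (J - j) + r) / 2 ^ (J - j) = 2 * k + 1 := by
        rw [add_comm, Nat.add_mul_div_right _ _ hd, hr', zero_add]
      have h2 : (2 * k * 2 ^ (J - j) + r) / 2 ^ (J - j) = 2 * k := by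
        rw [add_comm, Nat.add_mul_div_right _ _ hd, hr', zero_add]
      simp only [haarFun, h1, h2, if_neg h0]
      simp
      ring

/-- A coarser vector takes equal values at the two points of each matched pair, so every increment
vanishes; at equal level the supports are disjoint. -/
theorem haarVec_empInner_of_lt_or {J j k j' k' : ℕ} (h : (j, k) ∈ haarIndex (J + 1))
    (h' : (j', k') ∈ haarIndex (J + 1)) (hlt : j' < j ∨ j' = j ∧ k' ≠ k) :
    empInner (haarVec J (j', k')) (haarVec J (j, k)) = 0 := by
  rw [mem_haarIndex] at h h'
  obtain ⟨hj, h⟩ := h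
  obtain ⟨hj', h'⟩ := h'
  by_cases h0 : j = 0
  · rw [if_pos h0] at h
    rw [if_pos (by omega)] at h'
    omega
  rw [if_neg h0] at h
  rw [empInner_haarVec h0 (by omega) h _ _ (haarVec_apply J j' k'), Finset.sum_eq_zero, mul_zero]
  intro r hr
  have hd : 0 < 2 ^ (J - j) := by positivity
  have hr' : r / 2 ^ (J - j) = 0 := Nat.div_eq_of_lt (Finset.mem_range.1 hr)
  have h1 : ((2 * k + 1) * 2 ^ (J - j) + r) / 2 ^ (J - j) = 2 * k + 1 := by
    rw [add_comm, Nat.add_mul_div_right _ _ hd, hr', zero_add]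
  have h2 : (2 * k * 2 ^ (J - j) + r) / 2 ^ (J - j) = 2 * k := by
    rw [add_comm, Nat.add_mul_div_right _ _ hd, hr', zero_add]
  rcases hlt with hlt | ⟨rfl, hk⟩
  -- A strictly coarser block is at least twice as long, and one halving already merges the blocks
  -- `2k` and `2k + 1`.
  · obtain ⟨e, he⟩ : ∃ e, J - j' = (J - j) + (1 + e) := ⟨j - j' - 1, by omega⟩
    have key : ((2 * k + 1) * 2 ^ (J - j) + r) / 2 ^ (J - j') =
        (2 * k * 2 ^ (J - j) + r) / 2 ^ (J - j') := by
      rw [he, pow_add, ← Nat.div_div_eq_div_mul, ← Nat.div_div_eq_div_mul, h1, h2, pow_add, pow_one,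
        ← Nat.div_div_eq_div_mul, ← Nat.div_div_eq_div_mul]
      congr 1
      omega
    simp only [haarFun, key, sub_self]
  · simp only [haarFun, h1, h2, if_neg h0]
    rw [if_neg (by omega), if_neg (by omega), if_neg (by omega), if_neg (by omega)]
    simp

theorem empOrthonormal_haarVec (J : ℕ) : EmpOrthonormal (haarVec J) (haarIndex (J + 1)) := by
  refine ⟨fun a ha => haarVec_empInner_self (j := a.1) (k := a.2) ha, ?_⟩
  rintro ⟨j, k⟩ ha ⟨j', k'⟩ hb hab
  rw [ne_eq, Prod.mk.injEq] at hab
  rcases lt_trichotomy j j' with hlt | heq | hgt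
  · exact haarVec_empInner_of_lt_or hb ha (Or.inl hlt)
  · exact haarVec_empInner_of_lt_or hb ha (Or.inr ⟨heq, fun e => hab ⟨heq, e⟩⟩)
  · rw [empInner_comm]
    exact haarVec_empInner_of_lt_or ha hb (Or.inl hgt)

theorem residualVariance_haar {J : ℕ} (hJ : 1 ≤ J) (y : EuclideanSpace ℝ (Fin (2 ^ J))) :
    residualVariance (haarVec J) (haarIndex J) y = haarVariance J y := by
  rw [((empOrthonormal_haarVec J).mono (haarIndex_subset_succ J)).residualVariance_eq
    (by positivity), haarVariance]
  obtain ⟨I, rfl⟩ : ∃ I, J = I + 1 := ⟨J - 1, by omega⟩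
  rw [card_haarIndex_succ]
  push_cast
  rw [pow_succ]
  have : (0 : ℝ) < 2 ^ I := by positivity
  rw [show (2 : ℝ) ^ I * 2 - 2 ^ I = 2 ^ I by ring]
  field_simp

theorem haarEstimator_eq_haarShrinkage {J : ℕ} (hJ : 1 ≤ J) (β : ℝ)
    (y : EuclideanSpace ℝ (Fin (2 ^ J))) : haarEstimator J β y = haarShrinkage J β y := by
  have hcard : ((haarIndex J).card : ℝ) = 2 ^ J / 2 := by
    obtain ⟨I, rfl⟩ : ∃ I, J = I + 1 := ⟨J - 1, by omega⟩
    rw [card_haarIndex_succ]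
    push_cast
    ring
  have hpos : 0 < (haarIndex J).card := by
    have : (0 : ℝ) < (haarIndex J).card := by rw [hcard]; positivity
    exact_mod_cast this
  rw [haarEstimator, ((empOrthonormal_haarVec J).mono
    (haarIndex_subset_succ J)).mixingEstimator_eq (by positivity) hpos, haarShrinkage,
    residualVariance_haar hJ, hcard]
  push_cast
  simp only [mul_div_assoc]

/-- By Parseval in the full basis the residual energy is that of level `J` alone; independence of
`σ̂²` from the coefficients in `haarIndex J` rests on this. -/
theorem haarVariance_eq_sum (J : ℕ) (y : EuclideanSpace ℝ (Fin (2 ^ J))) :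
    haarVariance J y = 2 * ∑ a ∈ haarLevel J, empInner y (haarVec J a) ^ 2 := by
  rw [haarVariance, (empOrthonormal_haarVec J).parseval (by positivity) (card_haarIndex_succ J),
    haarIndex_succ, Finset.sum_union (disjoint_haarLevel_haarIndex J), add_sub_cancel_right]

end Haar

/-! ### Haar coefficients of functions of bounded variation. -/

section BoundedVariation

theorem sum_abs_sub_le_totalVariation {f : ℝ → ℝ} (hf : BoundedVariationOn f (Set.Icc 0 1))
    {u : ℕ → ℝ} (hu : Monotone u) (hu' : ∀ i, u i ∈ Set.Icc (0 : ℝ) 1) (N : ℕ) :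
    ∑ i ∈ Finset.range N, |f (u (i + 1)) - f (u i)| ≤ totalVariation f := by
  have h := eVariationOn.sum_le (f := f) (s := Set.Icc 0 1) (n := N) hu hu'
  have h2 : _ ≤ totalVariation f := ENNReal.toReal_mono hf h
  rw [ENNReal.toReal_sum (fun i _ => edist_ne_top _ _)] at h2
  simpa only [edist_dist, Real.dist_eq, ENNReal.toReal_ofReal (abs_nonneg _)] using h2

theorem sum_range_two_mul_le {N : ℕ} {g : ℕ → ℝ} (hg : ∀ i, 0 ≤ g i) :
    ∑ k ∈ Finset.range N, g (2 * k) ≤ ∑ i ∈ Finset.range (2 * N), g i := by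
  induction N with
  | zero => simp
  | succ N ih =>
    rw [Finset.sum_range_succ, mul_add, mul_one, Finset.sum_range_succ, Finset.sum_range_succ]
    linarith [hg (2 * N + 1)]

theorem totalVariation_nonneg (f : ℝ → ℝ) : 0 ≤ totalVariation f := ENNReal.toReal_nonneg

theorem haarScale_le {j : ℕ} (h0 : j ≠ 0) :
    (2 : ℝ) ^ (((j : ℝ) - 1) / 2) / 2 ^ j ≤ (√2)⁻¹ ^ j := by
  refine (sq_le_sq₀ (by positivity) (by positivity)).1 ?_
  obtain ⟨i, rfl⟩ : ∃ i, j = i + 1 := ⟨j - 1, by omega⟩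
  rw [div_pow, rpow_half_sq h0, Nat.add_sub_cancel, ← pow_mul (√2)⁻¹, mul_comm (i + 1) 2,
    pow_mul (√2)⁻¹, inv_pow, Real.sq_sqrt (by norm_num), inv_pow, ← one_div,
    div_le_div_iff₀ (by positivity) (by positivity)]
  have : (0 : ℝ) < 2 ^ i := by positivity
  rw [pow_succ]
  nlinarith [sq_nonneg ((2 : ℝ) ^ i)]

/-- For a fixed offset `r`, the matched pairs of all the blocks of the level lie along one
increasing sequence of design points, so their increments sum to at most `V`. Summing over the `2 ^
(J - j)` offsets and normalizing leaves `V 2^{(j-1)/2} / 2^j`. -/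
theorem sum_abs_empInner_signal_le {J j : ℕ} (h0 : j ≠ 0) (hj : j ≤ J)
    {x : Fin (2 ^ J + 1) → ℝ} (hx : StrictMono x) (hx0 : x 0 = 0)
    (hx1 : x (Fin.last (2 ^ J)) = 1) {f : ℝ → ℝ} (hf : BoundedVariationOn f (Set.Icc 0 1)) :
    ∑ a ∈ haarLevel j, |empInner (signal f x) (haarVec J a)| ≤
      totalVariation f * (√2)⁻¹ ^ j := by
  -- Freezing the design at its last point gives a monotone sequence on all of `ℕ`.
  set X : ℕ → ℝ := fun i => x ⟨min i (2 ^ J), by omega⟩ with hX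
  have hXm : Monotone X := fun a b hab => hx.monotone (by
    simp only [Fin.mk_le_mk]
    omega)
  have hXI : ∀ i, X i ∈ Set.Icc (0 : ℝ) 1 := fun i =>
    ⟨hx0 ▸ hx.monotone (Fin.zero_le _), hx1 ▸ hx.monotone (Fin.le_last _)⟩
  have hF : ∀ i : Fin (2 ^ J), signal f x i = f (X i) := by
    intro i
    simp only [signal, hX]
    congr 2
    ext
    simp only [Fin.val_castSucc]
    omega
  set d := J - j with hd
  set c := (2 : ℝ) ^ (((j : ℝ) - 1) / 2) with hc
  have hcpos : 0 < c := by positivity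
  have h1 : ∀ k ∈ Finset.range (2 ^ (j - 1)), |empInner (signal f x) (haarVec J (j, k))| ≤
      c / 2 ^ J * ∑ r ∈ Finset.range (2 ^ d),
        |f (X ((2 * k + 1) * 2 ^ d + r)) - f (X (2 * k * 2 ^ d + r))| := by
    intro k hk
    rw [empInner_haarVec h0 hj (Finset.mem_range.1 hk) _ (fun i => f (X i)) hF, abs_mul,
      abs_of_pos (by positivity)]
    gcongr
    exact Finset.abs_sum_le_sum_abs _ _
  rw [haarLevel, if_neg h0, Finset.sum_product, Finset.sum_singleton]
  refine (Finset.sum_le_sum h1).trans ?_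
  rw [← Finset.mul_sum, Finset.sum_comm]
  have h2 : ∀ r ∈ Finset.range (2 ^ d), ∑ k ∈ Finset.range (2 ^ (j - 1)),
      |f (X ((2 * k + 1) * 2 ^ d + r)) - f (X (2 * k * 2 ^ d + r))| ≤ totalVariation f := by
    intro r _
    have hm : Monotone fun l => X (l * 2 ^ d + r) := fun a b hab => hXm (by gcongr)
    -- The matched pairs are the increments from even to odd `l`; adding the others completes a full
    -- variation sum.
    refine (sum_range_two_mul_le
      (g := fun l => |f (X ((l + 1) * 2 ^ d + r)) - f (X (l * 2 ^ d + r))|)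
      fun _ => abs_nonneg _).trans ?_
    exact sum_abs_sub_le_totalVariation hf hm (fun _ => hXI _) _
  refine (mul_le_mul_of_nonneg_left (Finset.sum_le_sum h2) (by positivity)).trans ?_
  rw [Finset.sum_const, Finset.card_range, nsmul_eq_mul]
  push_cast
  have h3 : c / 2 ^ J * (2 ^ d * totalVariation f) = totalVariation f * (c / 2 ^ j) := by
    have : (2 : ℝ) ^ J = 2 ^ d * 2 ^ j := by rw [← pow_add, hd, Nat.sub_add_cancel hj]
    rw [this]
    field_simp
  rw [h3]
  exact mul_le_mul_of_nonneg_left (haarScale_le h0) (totalVariation_nonneg f)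

end BoundedVariation

/-! ### The scalar shrinkage factor. -/

section Shrink

/-- The shrinkage factor `e^t / (A + e^t)`. -/
def shrink (A t : ℝ) : ℝ := Real.exp t / (A + Real.exp t)

theorem shrink_nonneg {A : ℝ} (hA : 0 < A) (t : ℝ) : 0 ≤ shrink A t := by
  unfold shrink
  positivity

theorem shrink_le_one {A : ℝ} (hA : 0 < A) (t : ℝ) : shrink A t ≤ 1 := by
  unfold shrink
  rw [div_le_one (by positivity)]
  linarith

theorem shrink_mono {A : ℝ} (hA : 0 < A) : Monotone (shrink A) := by
  intro s t h
  unfold shrink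
  rw [div_le_div_iff₀ (by positivity) (by positivity)]
  nlinarith [Real.exp_le_exp.2 h]

theorem measurable_shrink (A : ℝ) : Measurable (shrink A) := by
  unfold shrink
  fun_prop

/-- The factor `1 - shrink A u = A / (A + e^u)` decays exponentially once `u` exceeds `log A`, so
`log A` acts as a soft threshold for `u`. -/
theorem mul_one_sub_shrink_le {A u : ℝ} (hA : 1 ≤ A) :
    u * (1 - shrink A u) ≤ Real.log A + 1 := by
  have hA0 : 0 < A := by linarith
  have hL : 0 ≤ Real.log A := Real.log_nonneg hA
  have h1 : 1 - shrink A u = A / (A + Real.exp u) := by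
    unfold shrink
    field_simp
    ring
  rw [h1, ← mul_div_assoc, div_le_iff₀ (by positivity)]
  rcases le_total u (Real.log A + 1) with h | h
  · have := Real.exp_pos u
    nlinarith
  · have h2 : Real.exp u = A * Real.exp (u - Real.log A) := by
      rw [Real.exp_sub, Real.exp_log hA0]
      field_simp
    have h3 := Real.add_one_le_exp (u - Real.log A)
    rw [h2]
    have h4 : u ≤ (Real.log A + 1) * (1 + Real.exp (u - Real.log A)) := by nlinarith
    nlinarith

end Shrink

/-! ### Second moment of a shrunk Gaussian variable. -/

section Gaussian

/-- Up to `u = log A` the left side is about `1/A`, and beyond it decays faster than `exp (-u / log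
A)`. With `u = z²/2` the right side is a Gaussian profile of variance `log A`, hence explicitly
integrable. -/
theorem inv_add_exp_le {A u : ℝ} (hA : Real.exp 1 ≤ A) :
    (A + Real.exp u)⁻¹ ≤ Real.exp 1 / A * Real.exp (-(u / Real.log A)) := by
  have hA0 : 0 < A := (Real.exp_pos 1).trans_le hA
  have hL : 1 ≤ Real.log A := by rwa [Real.le_log_iff_exp_le hA0]
  have hL0 : 0 < Real.log A := by linarith
  rw [Real.exp_neg, inv_le_iff_one_le_mul₀ (by positivity), div_mul_eq_mul_div,
    ← div_eq_mul_inv, div_div, div_mul_eq_mul_div, le_div_iff₀ (by positivity), one_mul]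
  have hu := Real.exp_pos u
  have he := Real.exp_pos 1
  rcases le_total u (Real.log A) with h | h
  · have : Real.exp (u / Real.log A) ≤ Real.exp 1 :=
      Real.exp_le_exp.2 ((div_le_one hL0).2 h)
    nlinarith
  · have h1 : Real.log A + u / Real.log A ≤ 1 + u := by
      have : u / Real.log A - 1 ≤ u - Real.log A := by
        rw [div_sub_one hL0.ne', div_le_iff₀ hL0]
        nlinarith
      linarith
    have h2 := Real.exp_le_exp.2 h1
    rw [Real.exp_add, Real.exp_add, Real.exp_log hA0] at h2
    nlinarith

theorem integrable_inv_add_exp {A : ℝ} (hA : 0 < A) :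
    Integrable fun z : ℝ => (A + Real.exp (z ^ 2 / 2))⁻¹ := by
  refine (integrable_exp_neg_mul_sq (b := 1 / 2) (by norm_num)).mono'
    (by fun_prop) (Filter.Eventually.of_forall fun z => ?_)
  rw [Real.norm_of_nonneg (by positivity), show -(1 / 2) * z ^ 2 = -(z ^ 2 / 2) by ring,
    Real.exp_neg]
  gcongr
  linarith

theorem integral_inv_add_exp_le {A : ℝ} (hA : Real.exp 1 ≤ A) :
    ∫ z : ℝ, (A + Real.exp (z ^ 2 / 2))⁻¹ ≤
      Real.exp 1 / A * √(2 * Real.pi * Real.log A) := by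
  have hA0 : 0 < A := (Real.exp_pos 1).trans_le hA
  have hL : 1 ≤ Real.log A := by rwa [Real.le_log_iff_exp_le hA0]
  have hb : 0 < 1 / (2 * Real.log A) := by positivity
  have h1 : ∫ z : ℝ, Real.exp 1 / A * Real.exp (-(1 / (2 * Real.log A)) * z ^ 2) =
      Real.exp 1 / A * √(2 * Real.pi * Real.log A) := by
    rw [integral_const_mul, integral_gaussian]
    congr 2
    field_simp
  rw [← h1]
  refine integral_mono (integrable_inv_add_exp hA0)
    ((integrable_exp_neg_mul_sq hb).const_mul _) fun z => ?_
  refine (inv_add_exp_le hA).trans_eq ?_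
  congr 2
  field_simp

theorem integrable_sq_mul_exp_neg_sq : Integrable fun z : ℝ => z ^ 2 * Real.exp (-(z ^ 2 / 2)) := by
  have h := integrable_rpow_mul_exp_neg_mul_sq (b := 1 / 2) (by norm_num) (s := 2) (by norm_num)
  refine h.congr (Filter.Eventually.of_forall fun z => ?_)
  simp only [Real.rpow_ofNat]
  congr 2
  ring

/-- Integration by parts: the integrand is `z` times the derivative of `-(A + exp (z²/2))⁻¹`. -/
theorem integral_sq_mul_exp_div {A : ℝ} (hA : 0 < A) :
    Integrable (fun z : ℝ => z ^ 2 * (Real.exp (z ^ 2 / 2) / (A + Real.exp (z ^ 2 / 2)) ^ 2)) ∧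
    ∫ z : ℝ, z ^ 2 * (Real.exp (z ^ 2 / 2) / (A + Real.exp (z ^ 2 / 2)) ^ 2) =
      ∫ z : ℝ, (A + Real.exp (z ^ 2 / 2))⁻¹ := by
  have hpos : ∀ z : ℝ, 0 < A + Real.exp (z ^ 2 / 2) := fun z => by positivity
  have hI : Integrable
      (fun z : ℝ => z ^ 2 * (Real.exp (z ^ 2 / 2) / (A + Real.exp (z ^ 2 / 2)) ^ 2)) := by
    refine integrable_sq_mul_exp_neg_sq.mono' (by fun_prop (disch := intro z; positivity))
      (Filter.Eventually.of_forall fun z => ?_)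
    rw [Real.norm_of_nonneg (by positivity), Real.exp_neg]
    have := Real.exp_pos (z ^ 2 / 2)
    gcongr
    rw [div_le_iff₀ (by positivity), ← div_eq_inv_mul, le_div_iff₀ this]
    nlinarith
  refine ⟨hI, ?_⟩
  have hv : ∀ z : ℝ, HasDerivAt (fun z : ℝ => -(A + Real.exp (z ^ 2 / 2))⁻¹)
      (z * (Real.exp (z ^ 2 / 2) / (A + Real.exp (z ^ 2 / 2)) ^ 2)) z := by
    intro z
    have h1 : HasDerivAt (fun z : ℝ => A + Real.exp (z ^ 2 / 2))
        (Real.exp (z ^ 2 / 2) * z) z := by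
      refine ((((hasDerivAt_pow 2 z).div_const 2).exp).const_add A).congr_deriv ?_
      simp
    refine (h1.inv (hpos z).ne').neg.congr_deriv ?_
    ring
  have key := integral_mul_deriv_eq_deriv_mul_of_integrable (u := fun z : ℝ => z)
    (u' := fun _ => 1) (v := fun z : ℝ => -(A + Real.exp (z ^ 2 / 2))⁻¹)
    (v' := fun z => z * (Real.exp (z ^ 2 / 2) / (A + Real.exp (z ^ 2 / 2)) ^ 2))
    (fun z _ => hasDerivAt_id z) (fun z _ => hv z) ?_ ?_ ?_
  · simp only [one_mul, integral_neg, neg_neg] at key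
    rw [← key]
    congr 1
    ext z
    ring
  · refine hI.congr (Filter.Eventually.of_forall fun z => ?_)
    simp only [Pi.mul_apply]
    ring
  · refine (integrable_inv_add_exp hA).neg.congr (Filter.Eventually.of_forall fun z => ?_)
    simp
  · refine (integrable_mul_exp_neg_mul_sq (b := 1 / 2) (by norm_num)).mono
      (by fun_prop (disch := intro z; positivity)) (Filter.Eventually.of_forall fun z => ?_)
    simp only [Pi.mul_apply, norm_mul, norm_neg]
    gcongr
    rw [Real.norm_of_nonneg (by positivity), Real.norm_of_nonneg (by positivity),
      show -(1 / 2) * z ^ 2 = -(z ^ 2 / 2) by ring, Real.exp_neg]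
    gcongr
    linarith

theorem gaussianPDFReal_zero_one (z : ℝ) :
    gaussianPDFReal 0 1 z = (√(2 * Real.pi))⁻¹ * Real.exp (-(z ^ 2 / 2)) := by
  rw [gaussianPDFReal_def]
  simp [neg_div]

/-- The Gaussian density cancels one of the two factors `exp (z²/2)` in the square, which leaves the
integrand of `integral_sq_mul_exp_div`. -/
theorem integral_sq_mul_shrink_sq_le {A : ℝ} (hA : Real.exp 1 ≤ A) :
    ∫ z, z ^ 2 * shrink A (z ^ 2 / 2) ^ 2 ∂gaussianReal 0 1 ≤ Real.exp 1 * Real.log A / A := by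
  have hA0 : 0 < A := (Real.exp_pos 1).trans_le hA
  have hL : 1 ≤ Real.log A := by rwa [Real.le_log_iff_exp_le hA0]
  rw [integral_gaussianReal_eq_integral_smul one_ne_zero]
  have h1 : ∀ z : ℝ, gaussianPDFReal 0 1 z • (z ^ 2 * shrink A (z ^ 2 / 2) ^ 2) =
      (√(2 * Real.pi))⁻¹ *
        (z ^ 2 * (Real.exp (z ^ 2 / 2) / (A + Real.exp (z ^ 2 / 2)) ^ 2)) := by
    intro z
    rw [gaussianPDFReal_zero_one, smul_eq_mul, shrink, Real.exp_neg]
    field_simp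
  simp_rw [h1]
  rw [integral_const_mul, (integral_sq_mul_exp_div hA0).2]
  refine (mul_le_mul_of_nonneg_left (integral_inv_add_exp_le hA) (by positivity)).trans ?_
  rw [Real.sqrt_mul (by positivity : 0 ≤ 2 * Real.pi)]
  have h2 : √(Real.log A) ≤ Real.log A := by
    rw [Real.sqrt_le_left (by linarith)]
    nlinarith
  have h3 : 0 < √(2 * Real.pi) := by positivity
  rw [show (√(2 * Real.pi))⁻¹ * (Real.exp 1 / A * (√(2 * Real.pi) * √(Real.log A))) =
    Real.exp 1 * √(Real.log A) / A by field_simp]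
  gcongr

/-- Equivalent to `cosh x * (1 - x²/2) ≤ 1`, which follows from `cosh x ≤ exp (x²/2)` and `1 - x²/2
≤ exp (-x²/2)`. -/
theorem cosh_le_one_add (x : ℝ) : Real.cosh x ≤ 1 + x ^ 2 / 2 * Real.cosh x := by
  have h1 := Real.cosh_le_exp_half_sq x
  have h2 := Real.add_one_le_exp (-(x ^ 2 / 2))
  rw [Real.exp_neg] at h2
  have h3 := Real.cosh_pos x
  have h4 := Real.exp_pos (x ^ 2 / 2)
  rcases le_total (1 - x ^ 2 / 2) 0 with h | h
  · nlinarith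
  · have : Real.cosh x * (1 - x ^ 2 / 2) ≤ Real.exp (x ^ 2 / 2) * (Real.exp (x ^ 2 / 2))⁻¹ := by
      gcongr
      linarith
    rw [mul_inv_cancel₀ h4.ne'] at this
    linarith

theorem sq_le_four_mul_cosh (x : ℝ) : x ^ 2 ≤ 4 * Real.cosh x := by
  have h1 := Real.quadratic_le_exp_of_nonneg (abs_nonneg x)
  rw [sq_abs] at h1
  rw [← Real.cosh_abs, Real.cosh_eq]
  have h2 := Real.exp_pos (-|x|)
  linarith [abs_nonneg x]

theorem cosh_pow_three_le (x : ℝ) : Real.cosh x ^ 3 ≤ Real.cosh (3 * x) := by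
  rw [Real.cosh_three_mul]
  nlinarith [Real.one_le_cosh x, sq_nonneg (Real.cosh x), mul_self_nonneg (Real.cosh x - 1)]

theorem integrable_cosh_gaussianReal (c : ℝ) :
    Integrable (fun z => Real.cosh (c * z)) (gaussianReal 0 1) := by
  simp_rw [Real.cosh_eq]
  have h := (integrable_exp_mul_gaussianReal (μ := 0) (v := 1) (-c))
  simp_rw [neg_mul] at h
  exact ((integrable_exp_mul_gaussianReal c).add h).div_const 2

theorem integral_cosh_gaussianReal (c : ℝ) :
    ∫ z, Real.cosh (c * z) ∂gaussianReal 0 1 = Real.exp (c ^ 2 / 2) := by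
  have h := (integrable_exp_mul_gaussianReal (μ := 0) (v := 1) (-c))
  have h1 : ∀ t : ℝ, ∫ z, Real.exp (t * z) ∂gaussianReal 0 1 = Real.exp (t ^ 2 / 2) := by
    intro t
    have := congrFun (mgf_fun_id_gaussianReal (μ := 0) (v := 1)) t
    simpa [mgf] using this
  have h2 := h1 (-c)
  simp_rw [neg_mul] at h h2
  simp_rw [Real.cosh_eq]
  rw [integral_div, integral_add (integrable_exp_mul_gaussianReal c) h, h1, h2]
  simp

theorem integrable_sq_gaussianReal (θ : ℝ) :
    Integrable (fun z => (θ + z) ^ 2) (gaussianReal 0 1) := by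
  have := (memLp_const θ).add (memLp_id_gaussianReal (μ := 0) (v := 1) 2)
  exact this.integrable_sq

theorem integral_sq_gaussianReal (θ : ℝ) :
    ∫ z, (θ + z) ^ 2 ∂gaussianReal 0 1 = θ ^ 2 + 1 := by
  have h0 : Integrable (fun z : ℝ => z) (gaussianReal 0 1) :=
    (memLp_id_gaussianReal (μ := 0) (v := 1) 1).integrable (by simp)
  have h2 : Integrable (fun z : ℝ => z ^ 2) (gaussianReal 0 1) := by
    simpa using integrable_sq_gaussianReal 0
  have hv : ∫ z, z ^ 2 ∂gaussianReal 0 1 = 1 := by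
    have := variance_fun_id_gaussianReal (μ := 0) (v := 1)
    rw [variance_eq_integral (by fun_prop)] at this
    simpa using this
  simp_rw [add_sq]
  have h3 : Integrable (fun z : ℝ => θ ^ 2 + 2 * θ * z) (gaussianReal 0 1) :=
    (integrable_const _).add (h0.const_mul _)
  rw [integral_add h3 h2,
    integral_add (integrable_const _) (h0.const_mul _), integral_const_mul,
    integral_id_gaussianReal, hv]
  simp

/-- A shift by `θ` weights the Gaussian law by `exp (θz - θ²/2)`. As `h` is even, `exp (θz)` may be
replaced by `cosh (θz)`, which has no term linear in `θ`; a small mean therefore costs only `θ²`. -/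
theorem integral_even_shift_le {h : ℝ → ℝ} (hm : Measurable h) (he : ∀ z, h (-z) = h z)
    (h0 : ∀ z, 0 ≤ h z) (h2 : ∀ z, h z ≤ z ^ 2) (θ : ℝ) :
    ∫ z, h (θ + z) ∂gaussianReal 0 1 ≤
      8 * Real.exp (9 / 2) * θ ^ 2 + ∫ z, h z ∂gaussianReal 0 1 := by
  have hint : ∀ t : ℝ, Integrable (fun z => h (t + z)) (gaussianReal 0 1) := fun t =>
    (integrable_sq_gaussianReal t).mono'
      (hm.comp (measurable_const_add t)).aestronglyMeasurable (Filter.Eventually.of_forall fun z => by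
      rw [Real.norm_of_nonneg (h0 _)]
      exact h2 _)
  have hint0 : Integrable h (gaussianReal 0 1) := by simpa using hint 0
  have hnn : 0 ≤ ∫ z, h z ∂gaussianReal 0 1 := integral_nonneg h0
  have he1 : 1 ≤ Real.exp (9 / 2) := Real.one_le_exp (by norm_num)
  -- For `|θ| ≥ 1` the crude bound `θ² + 1 ≤ 2θ²` suffices; the change of measure serves `|θ| ≤ 1`,
  -- where `cosh (θz) ≤ cosh z`.
  rcases le_total 1 |θ| with hθ | hθ
  · have h3 : ∫ z, h (θ + z) ∂gaussianReal 0 1 ≤ θ ^ 2 + 1 := by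
      rw [← integral_sq_gaussianReal]
      exact integral_mono (hint θ) (integrable_sq_gaussianReal θ) fun z => h2 _
    have h4 : 1 ≤ θ ^ 2 := (one_le_sq_iff_one_le_abs θ).2 hθ
    nlinarith
  · have hcosh : ∀ z, Real.cosh (θ * z) ≤ Real.cosh z := fun z => by
      rw [Real.cosh_le_cosh, abs_mul]
      exact mul_le_of_le_one_left (abs_nonneg z) hθ
    have hexp : ∀ z, Real.exp (θ * z) ≤ 2 * Real.cosh z ∧ Real.exp (-θ * z) ≤ 2 * Real.cosh z := by
      intro z
      have := hcosh z
      rw [Real.cosh_eq, ← neg_mul] at this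
      constructor <;> linarith [Real.exp_pos (θ * z), Real.exp_pos (-θ * z)]
    have hI : ∀ t : ℝ, (∀ z, Real.exp (t * z) ≤ 2 * Real.cosh z) →
        Integrable (fun z => h z * Real.exp (t * z)) (gaussianReal 0 1) := by
      intro t ht
      refine ((integrable_cosh_gaussianReal 3).const_mul 8).mono' (by fun_prop)
        (Filter.Eventually.of_forall fun z => ?_)
      rw [Real.norm_of_nonneg (mul_nonneg (h0 z) (Real.exp_pos _).le)]
      have h3 : h z * Real.exp (t * z) ≤ (4 * Real.cosh z) * (2 * Real.cosh z) :=
        mul_le_mul ((h2 z).trans (sq_le_four_mul_cosh z)) (ht z) (Real.exp_pos _).le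
          (by linarith [Real.cosh_pos z])
      have h4 := cosh_pow_three_le z
      have h5 := Real.one_le_cosh z
      nlinarith [mul_nonneg (sq_nonneg (Real.cosh z)) (sub_nonneg.2 h5)]
    have hshift : ∀ t : ℝ, ∫ z, h (t + z) ∂gaussianReal 0 1 =
          Real.exp (-(t ^ 2 / 2)) * ∫ z, h z * Real.exp (t * z) ∂gaussianReal 0 1 := by
      intro t
      have h3 : ∫ z, h (t + z) ∂gaussianReal 0 1 = ∫ z, h z ∂gaussianReal t 1 := by
        have h4 := gaussianReal_map_const_add (μ := 0) (v := 1) t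
        rw [zero_add] at h4
        rw [← h4, integral_map (by fun_prop) (by fun_prop)]
      rw [h3, integral_gaussianReal_eq_integral_smul one_ne_zero,
        integral_gaussianReal_eq_integral_smul one_ne_zero, ← integral_const_mul]
      congr 1
      ext z
      rw [gaussianPDFReal_zero_one, gaussianPDFReal_def, smul_eq_mul, smul_eq_mul]
      beta_reduce
      have h5 : Real.exp (-(z - t) ^ 2 / (2 * ((1 : NNReal) : ℝ))) =
          Real.exp (-(t ^ 2 / 2)) * Real.exp (t * z) * Real.exp (-(z ^ 2 / 2)) := by
        rw [← Real.exp_add, ← Real.exp_add]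
        congr 1
        push_cast
        ring
      rw [h5]
      push_cast
      rw [mul_one]
      ring
    have hneg : ∫ z, h (-θ + z) ∂gaussianReal 0 1 = ∫ z, h (θ + z) ∂gaussianReal 0 1 := by
      have h3 := gaussianReal_map_neg (μ := 0) (v := 1)
      rw [neg_zero] at h3
      conv_lhs => rw [← h3]
      have hm' : Measurable fun z => h (-θ + z) := hm.comp (measurable_const_add _)
      rw [integral_map (by fun_prop) hm'.aestronglyMeasurable]
      congr 1
      ext z
      rw [← he]
      congr 1
      ring
    have hθI := hI θ fun z => (hexp z).1
    have hθI' := hI (-θ) fun z => (hexp z).2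
    have hsum : ∫ z, h (θ + z) ∂gaussianReal 0 1 =
        Real.exp (-(θ ^ 2 / 2)) * ∫ z, h z * Real.cosh (θ * z) ∂gaussianReal 0 1 := by
      have h3 : ∀ z, h z * Real.cosh (θ * z) =
          (h z * Real.exp (θ * z) + h z * Real.exp (-θ * z)) / 2 := by
        intro z
        rw [Real.cosh_eq, neg_mul]
        ring
      simp_rw [h3]
      rw [integral_div, integral_add hθI hθI']
      have h4 := hshift θ
      have h5 := hshift (-θ)
      rw [hneg, neg_sq] at h5
      linarith
    have hcI : Integrable (fun z => h z * Real.cosh (θ * z)) (gaussianReal 0 1) := by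
      refine ((hθI.add hθI').div_const 2).congr (Filter.Eventually.of_forall fun z => ?_)
      simp only [Pi.add_apply, Real.cosh_eq, neg_mul]
      ring
    -- The constant `8` is `4 * 4 / 2`, from `z² ≤ 4 cosh z` used twice; `exp (9/2)` is the Gaussian
    -- mean of `cosh (3z)`.
    have hbound : ∫ z, h z * Real.cosh (θ * z) ∂gaussianReal 0 1 ≤
        8 * θ ^ 2 * Real.exp (9 / 2) + ∫ z, h z ∂gaussianReal 0 1 := by
      have h3 := integral_cosh_gaussianReal 3
      rw [show (3 : ℝ) ^ 2 / 2 = 9 / 2 by norm_num] at h3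
      rw [← h3, ← integral_const_mul,
        ← integral_add ((integrable_cosh_gaussianReal 3).const_mul _) hint0]
      refine integral_mono hcI (((integrable_cosh_gaussianReal 3).const_mul _).add hint0)
        fun z => ?_
      have h4 := cosh_le_one_add (θ * z)
      have h5 := hcosh z
      have h6 := sq_le_four_mul_cosh z
      have h7 := cosh_pow_three_le z
      have hc := Real.cosh_pos z
      have hc' := Real.cosh_pos (θ * z)
      change h z * Real.cosh (θ * z) ≤ 8 * θ ^ 2 * Real.cosh (3 * z) + h z
      calc h z * Real.cosh (θ * z)
          ≤ h z * (1 + (θ * z) ^ 2 / 2 * Real.cosh (θ * z)) :=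
            mul_le_mul_of_nonneg_left h4 (h0 z)
        _ = h z + θ ^ 2 / 2 * (h z * z ^ 2 * Real.cosh (θ * z)) := by ring
        _ ≤ h z + θ ^ 2 / 2 * ((4 * Real.cosh z) * (4 * Real.cosh z) * Real.cosh z) := by
            gcongr
            exact (h2 z).trans h6
        _ = h z + 8 * θ ^ 2 * Real.cosh z ^ 3 := by ring
        _ ≤ _ := by
            rw [add_comm]
            gcongr
    have hnn' : 0 ≤ ∫ z, h z * Real.cosh (θ * z) ∂gaussianReal 0 1 :=
      integral_nonneg fun z => mul_nonneg (h0 z) (Real.cosh_pos _).le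
    have hle : Real.exp (-(θ ^ 2 / 2)) ≤ 1 := Real.exp_le_one_iff.2 (by nlinarith [sq_nonneg θ])
    rw [hsum]
    nlinarith

/-- The second moment of a thresholded Gaussian variable, at the universal threshold. -/
theorem integral_sq_mul_shrink_sq_shift_le {A : ℝ} (hA : Real.exp 1 ≤ A) (θ : ℝ) :
    ∫ z, (θ + z) ^ 2 * shrink A ((θ + z) ^ 2 / 2) ^ 2 ∂gaussianReal 0 1 ≤
      8 * Real.exp (9 / 2) * θ ^ 2 + Real.exp 1 * Real.log A / A := by
  have hA0 : 0 < A := (Real.exp_pos 1).trans_le hA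
  have hms := measurable_shrink A
  refine (integral_even_shift_le (h := fun z => z ^ 2 * shrink A (z ^ 2 / 2) ^ 2)
    (by fun_prop) (fun z => by simp) (fun z => by positivity) (fun z => ?_) θ).trans ?_
  · have h1 := shrink_nonneg hA0 (z ^ 2 / 2)
    have h2 := shrink_le_one hA0 (z ^ 2 / 2)
    exact mul_le_of_le_one_right (sq_nonneg z) (pow_le_one₀ h1 h2)
  · gcongr
    exact integral_sq_mul_shrink_sq_le hA

end Gaussian

/-! ### Orthonormal changes of basis for Gaussian noise. -/

section GaussianVectors

variable {Ω : Type*} [MeasurableSpace Ω] {P : Measure Ω} [IsProbabilityMeasure P]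

theorem covariance_linear_forms {n : ℕ} {ε : Fin n → Ω → ℝ}
    (hε : ∀ i, HasLaw (ε i) (gaussianReal 0 1) P) (hind : iIndepFun ε P) (u w : Fin n → ℝ) :
    cov[fun ω => ∑ i, u i * ε i ω, fun ω => ∑ i, w i * ε i ω; P] = ∑ i, u i * w i := by
  have hmem : ∀ i, MemLp (ε i) 2 P := fun i => (hε i).hasGaussianLaw.memLp_two
  rw [covariance_fun_sum_fun_sum (fun i => (hmem i).const_mul _) (fun i => (hmem i).const_mul _)]
  refine Finset.sum_congr rfl fun i _ => ?_
  rw [Finset.sum_eq_single_of_mem i (Finset.mem_univ i)]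
  · rw [covariance_const_mul_left, covariance_const_mul_right,
      covariance_self (hε i).aemeasurable, (hε i).variance_eq, variance_id_gaussianReal]
    simp
  · intro j _ hji
    rw [covariance_const_mul_left, covariance_const_mul_right,
      (hind.indepFun hji.symm).covariance_eq_zero (hmem i) (hmem j), mul_zero, mul_zero]

/-- An orthonormal family of linear forms of a standard Gaussian vector is again independent and
standard Gaussian. -/
theorem orthonormal_linear_forms {n : ℕ} {κ : Type*} [Finite κ] {ε : Fin n → Ω → ℝ}
    (hε : ∀ i, HasLaw (ε i) (gaussianReal 0 1) P) (hind : iIndepFun ε P) (w : κ → Fin n → ℝ)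
    (hw1 : ∀ a, ∑ i, w a i * w a i = 1) (hw0 : ∀ a b, a ≠ b → ∑ i, w a i * w b i = 0) :
    (∀ a, HasLaw (fun ω => ∑ i, w a i * ε i ω) (gaussianReal 0 1) P) ∧
      iIndepFun (fun a ω => ∑ i, w a i * ε i ω) P := by
  have := Fintype.ofFinite κ
  have hjoint : HasGaussianLaw (fun ω i => ε i ω) P :=
    iIndepFun.hasGaussianLaw (fun i => (hε i).hasGaussianLaw) hind
  let T : (Fin n → ℝ) →L[ℝ] (κ → ℝ) :=
    ContinuousLinearMap.pi fun a => ∑ i, w a i • ContinuousLinearMap.proj (R := ℝ) i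
  have hT : HasGaussianLaw (fun ω a => ∑ i, w a i * ε i ω) P := by
    have h := hjoint.map_fun T
    have he : (fun ω => T fun i => ε i ω) = fun ω a => ∑ i, w a i * ε i ω := by
      ext ω a
      simp [T]
    rwa [he] at h
  refine ⟨fun a => ?_, ?_⟩
  · have ha : HasGaussianLaw (fun ω => ∑ i, w a i * ε i ω) P := hT.eval a
    refine ⟨ha.aemeasurable, ?_⟩
    have hmean : ∫ ω, ∑ i, w a i * ε i ω ∂P = 0 := by
      rw [integral_finsetSum _ fun i _ => (hε i).hasGaussianLaw.integrable.const_mul _]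
      refine Finset.sum_eq_zero fun i _ => ?_
      rw [integral_const_mul, (hε i).integral_eq, integral_id_gaussianReal, mul_zero]
    have hvar : Var[fun ω => ∑ i, w a i * ε i ω; P] = 1 := by
      rw [← covariance_self ha.aemeasurable, covariance_linear_forms hε hind, hw1]
    rw [ha.map_eq_gaussianReal, hmean, hvar, Real.toNNReal_one]
  -- Under joint Gaussianity, zero covariances give independence.
  · refine hT.iIndepFun_of_covariance_eq_zero fun a b hab => ?_
    rw [covariance_linear_forms hε hind, hw0 a b hab]

end GaussianVectors

/-! ### Lower tail of noncentral chi-square variables. -/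

section LowerTail

/-- Completing the square leaves a nonnegative term in `η²`, which is dropped: noncentrality only
lightens the lower tail, so the signal on level `J` does no harm there. -/
theorem integral_exp_neg_mul_sq_gaussianReal_le {t : ℝ} (ht : 0 < t) (η : ℝ) :
    ∫ z, Real.exp (-t * (η + z) ^ 2) ∂gaussianReal 0 1 ≤ √(1 / (1 + 2 * t)) := by
  rw [integral_gaussianReal_eq_integral_smul one_ne_zero]
  have ht' : 0 < t + 1 / 2 := by linarith
  set c := t * η / (t + 1 / 2) with hc
  have hI : Integrable fun z : ℝ =>
      (√(2 * Real.pi))⁻¹ * Real.exp (-(t + 1 / 2) * (z + c) ^ 2) :=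
    ((integrable_exp_neg_mul_sq ht').comp_add_right c).const_mul _
  have hval : ∫ z : ℝ, (√(2 * Real.pi))⁻¹ * Real.exp (-(t + 1 / 2) * (z + c) ^ 2) =
      √(1 / (1 + 2 * t)) := by
    rw [integral_const_mul, integral_add_right_eq_self
      (fun z : ℝ => Real.exp (-(t + 1 / 2) * z ^ 2)), integral_gaussian,
      ← Real.sqrt_inv, ← Real.sqrt_mul (by positivity)]
    congr 1
    have := Real.pi_pos
    field_simp
    ring
  rw [← hval]
  refine integral_mono_of_nonneg (Filter.Eventually.of_forall fun z => ?_) hI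
    (Filter.Eventually.of_forall fun z => ?_)
  · exact smul_nonneg (gaussianPDFReal_nonneg _ _ _) (Real.exp_pos _).le
  · beta_reduce
    rw [gaussianPDFReal_zero_one, smul_eq_mul, mul_assoc, ← Real.exp_add]
    gcongr
    have h1 : t * (η + z) ^ 2 + z ^ 2 / 2 - (t + 1 / 2) * (z + c) ^ 2 =
        t * η ^ 2 / (2 * (t + 1 / 2)) := by
      rw [hc]
      field_simp
      ring
    have h2 : 0 ≤ t * η ^ 2 / (2 * (t + 1 / 2)) := by positivity
    linarith

variable {Ω : Type*} [MeasurableSpace Ω] {P : Measure Ω} [IsProbabilityMeasure P]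

/-- The Chernoff bound for the lower tail of a noncentral chi-square variable. -/
theorem measure_sum_sq_le {κ : Type*} {ξ : κ → Ω → ℝ}
    (hξ : ∀ a, HasLaw (ξ a) (gaussianReal 0 1) P) (hind : iIndepFun ξ P) (S : Finset κ)
    (η : κ → ℝ) {x : ℝ} (hx0 : 0 < x) (hx1 : x < 1) :
    P.real {ω | ∑ a ∈ S, (η a + ξ a ω) ^ 2 ≤ S.card * x} ≤ Real.exp (-(S.card * phi x)) := by
  -- The optimal Chernoff parameter: `1 + 2t = 1/x`, and the exponent becomes `-S.card * phi x`.
  set t := (1 / x - 1) / 2 with ht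
  have htpos : 0 < t := by
    have : 1 < 1 / x := by rw [lt_div_iff₀ hx0]; linarith
    rw [ht]
    linarith
  have hmeas : ∀ a, AEMeasurable (ξ a) P := fun a => (hξ a).aemeasurable
  let X : κ → Ω → ℝ := fun a ω => (η a + ξ a ω) ^ 2
  have hX : ∀ a, AEMeasurable (X a) P := fun a => ((hmeas a).const_add _).pow_const 2
  have hXind : iIndepFun X P :=
    hind.comp (fun a z => (η a + z) ^ 2) fun a => by fun_prop
  have hint : Integrable (fun ω => Real.exp (-t * (∑ a ∈ S, X a) ω)) P := by
    refine (integrable_const (1 : ℝ)).mono' ?_ (Filter.Eventually.of_forall fun ω => ?_)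
    · exact (Real.measurable_exp.comp_aemeasurable
        ((Finset.aemeasurable_sum S fun a _ => hX a).const_mul _)).aestronglyMeasurable
    · rw [Real.norm_of_nonneg (Real.exp_pos _).le, Real.exp_le_one_iff, Finset.sum_apply]
      have : 0 ≤ ∑ a ∈ S, X a ω := Finset.sum_nonneg fun a _ => sq_nonneg _
      nlinarith
  have hmgf : ∀ a, mgf (X a) P (-t) ≤ √x := by
    intro a
    have h1 := (hξ a).integral_comp (f := fun z => Real.exp (-t * (η a + z) ^ 2)) (by fun_prop)
    have h2 := integral_exp_neg_mul_sq_gaussianReal_le htpos (η a)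
    rw [show 1 / (1 + 2 * t) = x by rw [ht]; field_simp; ring, ← h1] at h2
    exact h2
  have h := measure_le_le_exp_mul_mgf (X := ∑ a ∈ S, X a) (S.card * x) (by linarith : -t ≤ 0) hint
  rw [hXind.mgf_sum₀ hX] at h
  have hprod : ∏ a ∈ S, mgf (X a) P (-t) ≤ √x ^ S.card := by
    rw [← Finset.prod_const]
    exact Finset.prod_le_prod (fun a _ => mgf_nonneg) fun a _ => hmgf a
  have hset : {ω | ∑ a ∈ S, (η a + ξ a ω) ^ 2 ≤ S.card * x} =
      {ω | (∑ a ∈ S, X a) ω ≤ S.card * x} := by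
    ext ω
    simp only [Set.mem_ofPred_eq, Finset.sum_apply, X]
  rw [hset]
  refine h.trans ((mul_le_mul_of_nonneg_left hprod (Real.exp_pos _).le).trans_eq ?_)
  have hs : √x = Real.exp (Real.log x / 2) := by
    rw [← Real.log_sqrt hx0.le, Real.exp_log (by positivity)]
  rw [hs, ← Real.exp_nat_mul, ← Real.exp_add, phi, ht]
  congr 1
  field_simp
  ring

end LowerTail

/-! ### Two bounds on the risk of a single coordinate. -/

section CoordinateRisk

variable {Ω : Type*} [MeasurableSpace Ω] {P : Measure Ω}

theorem integral_sq_affine {ξ : Ω → ℝ} (hξ : HasLaw ξ (gaussianReal 0 1) P) (θ : ℝ) {τ : ℝ}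
    (hτ : 0 < τ) : ∫ ω, (θ + τ * ξ ω) ^ 2 ∂P = θ ^ 2 + τ ^ 2 := by
  have h1 := hξ.integral_comp (f := fun z => (θ + τ * z) ^ 2) (by fun_prop)
  have h2 : ∀ z : ℝ, (θ + τ * z) ^ 2 = τ ^ 2 * (θ / τ + z) ^ 2 := fun z => by
    field_simp
  rw [Function.comp_def] at h1
  rw [h1]
  simp_rw [h2]
  rw [integral_const_mul, integral_sq_gaussianReal]
  field_simp

variable [IsProbabilityMeasure P]

theorem sq_shrink_sub_le {A : ℝ} (hA : 0 < A) (Z u θ : ℝ) :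
    (Z * shrink A u - θ) ^ 2 ≤ 2 * θ ^ 2 + 2 * Z ^ 2 := by
  have h1 := shrink_nonneg hA u
  have h2 := shrink_le_one hA u
  have h3 : (Z * shrink A u) ^ 2 ≤ Z ^ 2 := by
    rw [mul_pow]
    exact mul_le_of_le_one_right (sq_nonneg Z) (pow_le_one₀ h1 h2)
  nlinarith [sq_nonneg (Z * shrink A u + θ)]

theorem integrable_sq_affine {ξ : Ω → ℝ} (hξ : HasLaw ξ (gaussianReal 0 1) P) (θ τ : ℝ) :
    Integrable (fun ω => (θ + τ * ξ ω) ^ 2) P :=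
  ((memLp_const θ).add (hξ.hasGaussianLaw.memLp_two.const_mul τ)).integrable_sq

theorem integrable_shrink_risk {ξ s : Ω → ℝ} (hξ : HasLaw ξ (gaussianReal 0 1) P)
    (hs : AEMeasurable s P) {A : ℝ} (hA : 0 < A) (θ τ c : ℝ) :
    Integrable (fun ω => ((θ + τ * ξ ω) * shrink A (c * (θ + τ * ξ ω) ^ 2 / s ω) - θ) ^ 2) P := by
  have hm := hξ.aemeasurable
  have hms := measurable_shrink A
  refine ((integrable_const (2 * θ ^ 2)).add ((integrable_sq_affine hξ θ τ).const_mul 2)).mono'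
    (AEMeasurable.aestronglyMeasurable (by fun_prop)) (Filter.Eventually.of_forall fun ω => ?_)
  rw [Real.norm_of_nonneg (sq_nonneg _)]
  exact sq_shrink_sub_le hA _ _ _

/-- The risk of the shrinkage rule is at most of the order of the squared threshold. -/
theorem integral_shrink_risk_le_threshold {ξ s : Ω → ℝ} (hξ : HasLaw ξ (gaussianReal 0 1) P)
    (hs : Integrable s P) (hspos : ∀ᵐ ω ∂P, 0 < s ω) {A : ℝ} (hA : 1 ≤ A) (θ : ℝ) {τ c : ℝ}
    (hτ : 0 < τ) (hc : 0 < c) :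
    ∫ ω, ((θ + τ * ξ ω) * shrink A (c * (θ + τ * ξ ω) ^ 2 / s ω) - θ) ^ 2 ∂P ≤
      2 * τ ^ 2 + 2 * (Real.log A + 1) / c * ∫ ω, s ω ∂P := by
  have hA0 : 0 < A := by linarith
  have hI := integrable_sq_affine hξ 0 τ
  have h1 := integral_sq_affine hξ 0 hτ
  simp only [zero_add] at hI h1
  rw [zero_pow two_ne_zero, zero_add] at h1
  rw [← h1, ← integral_const_mul, ← integral_const_mul,
    ← integral_add (hI.const_mul 2) (hs.const_mul _)]
  refine integral_mono_ae (integrable_shrink_risk hξ hs.aemeasurable hA0 θ τ c)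
    ((hI.const_mul 2).add (hs.const_mul _)) ?_
  filter_upwards [hspos] with ω hω
  set Z := θ + τ * ξ ω with hZ
  set g := shrink A (c * Z ^ 2 / s ω) with hg
  have hg0 : 0 ≤ g := shrink_nonneg hA0 _
  have hg1 : g ≤ 1 := shrink_le_one hA0 _
  have h2 := mul_one_sub_shrink_le (A := A) (u := c * Z ^ 2 / s ω) hA
  rw [← hg, div_mul_eq_mul_div, div_le_iff₀ hω] at h2
  have h3 : Z ^ 2 * (1 - g) ≤ (Real.log A + 1) / c * s ω := by
    rw [div_mul_eq_mul_div, le_div_iff₀ hc]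
    linarith
  have h4 : Z ^ 2 * (1 - g) ^ 2 ≤ Z ^ 2 * (1 - g) := by
    apply mul_le_mul_of_nonneg_left _ (sq_nonneg Z)
    nlinarith
  -- The error is the noise minus the displacement `Z * (1 - g)` caused by the shrinkage.
  have h5 : (Z * g - θ) ^ 2 ≤ 2 * (τ * ξ ω) ^ 2 + 2 * (Z ^ 2 * (1 - g) ^ 2) := by
    have : Z * g - θ = τ * ξ ω - Z * (1 - g) := by rw [hZ]; ring
    rw [this]
    nlinarith [sq_nonneg (τ * ξ ω + Z * (1 - g))]
  change (Z * g - θ) ^ 2 ≤ 2 * (τ * ξ ω) ^ 2 + 2 * (Real.log A + 1) / c * s ω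
  have h6 : 2 * (Real.log A + 1) / c * s ω = 2 * ((Real.log A + 1) / c * s ω) := by ring
  linarith

/-- The risk of the shrinkage rule is at most of the order of the squared signal, up to the
probability that the threshold lies below the universal one. -/
theorem integral_shrink_risk_le_signal {ξ s : Ω → ℝ} (hξ : HasLaw ξ (gaussianReal 0 1) P)
    (hs : AEMeasurable s P) (hind : IndepFun ξ s P) {A : ℝ} (hA : Real.exp 1 ≤ A) (θ : ℝ)
    {τ c q : ℝ} (hτ : 0 < τ) (hc : 0 < c) (hq : P.real {ω | s ω ≤ 2 * c * τ ^ 2} ≤ q) :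
    ∫ ω, ((θ + τ * ξ ω) * shrink A (c * (θ + τ * ξ ω) ^ 2 / s ω) - θ) ^ 2 ∂P ≤
      2 * θ ^ 2 + 2 * (q * (θ ^ 2 + τ ^ 2)) +
        2 * (8 * Real.exp (9 / 2) * θ ^ 2 + τ ^ 2 * (Real.exp 1 * Real.log A / A)) := by
  have hA0 : 0 < A := (Real.exp_pos 1).trans_le hA
  have hm := hξ.aemeasurable
  have hms := measurable_shrink A
  -- Indicator of a variance estimate too small for the universal threshold. On this event the
  -- factor is merely bounded by `1`, and independence splits the expectation into a probability
  -- times `θ² + τ²`.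
  set B : ℝ → ℝ := Set.indicator (Set.Iic (2 * c * τ ^ 2)) (fun _ => 1) with hB
  have hBm : Measurable B := measurable_const.indicator measurableSet_Iic
  have hI := integrable_sq_affine hξ θ τ
  have hI1 : Integrable (fun ω => (θ + τ * ξ ω) ^ 2 * B (s ω)) P := by
    refine hI.mono' (AEMeasurable.aestronglyMeasurable (by fun_prop))
      (Filter.Eventually.of_forall fun ω => ?_)
    rw [norm_mul, Real.norm_of_nonneg (sq_nonneg _)]
    refine mul_le_of_le_one_right (sq_nonneg _) ?_
    simp only [hB, Set.indicator_apply]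
    split_ifs <;> simp
  have hI2 : Integrable
      (fun ω => (θ + τ * ξ ω) ^ 2 * shrink A ((θ / τ + ξ ω) ^ 2 / 2) ^ 2) P := by
    refine hI.mono' (AEMeasurable.aestronglyMeasurable (by fun_prop))
      (Filter.Eventually.of_forall fun ω => ?_)
    have h1 := shrink_nonneg hA0 ((θ / τ + ξ ω) ^ 2 / 2)
    have h2 := shrink_le_one hA0 ((θ / τ + ξ ω) ^ 2 / 2)
    rw [Real.norm_of_nonneg (by positivity)]
    exact mul_le_of_le_one_right (sq_nonneg _) (pow_le_one₀ h1 h2)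
  have hE1 : ∫ ω, (θ + τ * ξ ω) ^ 2 * B (s ω) ∂P ≤ q * (θ ^ 2 + τ ^ 2) := by
    have hind' : IndepFun (fun ω => (θ + τ * ξ ω) ^ 2) (fun ω => B (s ω)) P :=
      hind.comp (φ := fun z => (θ + τ * z) ^ 2) (ψ := B) (by fun_prop) hBm
    rw [hind'.integral_fun_mul_eq_mul_integral (AEMeasurable.aestronglyMeasurable (by fun_prop))
      (AEMeasurable.aestronglyMeasurable (by fun_prop)), integral_sq_affine hξ θ hτ, mul_comm]
    have hBint : ∫ ω, B (s ω) ∂P = P.real {ω | s ω ≤ 2 * c * τ ^ 2} := by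
      have h1 : (fun ω => B (s ω)) = Set.indicator {ω | s ω ≤ 2 * c * τ ^ 2} 1 := by
        ext ω
        simp [hB, Set.indicator_apply]
      have h2 : NullMeasurableSet {ω | s ω ≤ 2 * c * τ ^ 2} P :=
        hs.nullMeasurableSet_preimage measurableSet_Iic
      rw [h1, integral_indicator₀ h2]
      simp
    rw [hBint]
    gcongr
  have hE2 : ∫ ω, (θ + τ * ξ ω) ^ 2 * shrink A ((θ / τ + ξ ω) ^ 2 / 2) ^ 2 ∂P ≤
      8 * Real.exp (9 / 2) * θ ^ 2 + τ ^ 2 * (Real.exp 1 * Real.log A / A) := by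
    have h1 := hξ.integral_comp
      (f := fun z => (θ + τ * z) ^ 2 * shrink A ((θ / τ + z) ^ 2 / 2) ^ 2)
      (Measurable.aestronglyMeasurable (by fun_prop))
    rw [Function.comp_def] at h1
    rw [h1]
    have h2 : ∀ z : ℝ, (θ + τ * z) ^ 2 * shrink A ((θ / τ + z) ^ 2 / 2) ^ 2 =
        τ ^ 2 * ((θ / τ + z) ^ 2 * shrink A ((θ / τ + z) ^ 2 / 2) ^ 2) := fun z => by
      rw [← mul_assoc]
      congr 1
      field_simp
    simp_rw [h2]
    rw [integral_const_mul]
    refine (mul_le_mul_of_nonneg_left (integral_sq_mul_shrink_sq_shift_le hA _)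
      (sq_nonneg τ)).trans_eq ?_
    field_simp
  have hle : ∫ ω, ((θ + τ * ξ ω) * shrink A (c * (θ + τ * ξ ω) ^ 2 / s ω) - θ) ^ 2 ∂P ≤
      ∫ ω, (2 * θ ^ 2 + 2 * ((θ + τ * ξ ω) ^ 2 * B (s ω)) +
        2 * ((θ + τ * ξ ω) ^ 2 * shrink A ((θ / τ + ξ ω) ^ 2 / 2) ^ 2)) ∂P := by
    refine integral_mono (integrable_shrink_risk hξ hs hA0 θ τ c)
      (((integrable_const _).add (hI1.const_mul 2)).add (hI2.const_mul 2)) fun ω => ?_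
    beta_reduce
    set Z := θ + τ * ξ ω with hZ
    have hg0 := shrink_nonneg hA0 (c * Z ^ 2 / s ω)
    have hg1 := shrink_le_one hA0 (c * Z ^ 2 / s ω)
    have hkey : (Z * shrink A (c * Z ^ 2 / s ω)) ^ 2 ≤
        Z ^ 2 * B (s ω) + Z ^ 2 * shrink A ((θ / τ + ξ ω) ^ 2 / 2) ^ 2 := by
      rw [mul_pow, ← mul_add]
      refine mul_le_mul_of_nonneg_left ?_ (sq_nonneg Z)
      by_cases hω : s ω ≤ 2 * c * τ ^ 2
      · have hB1 : B (s ω) = 1 := by simp [hB, hω]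
        rw [hB1]
        nlinarith [sq_nonneg (shrink A ((θ / τ + ξ ω) ^ 2 / 2))]
      · have hB0 : B (s ω) = 0 := by simp [hB, hω]
        rw [hB0, zero_add]
        refine pow_le_pow_left₀ hg0 (shrink_mono hA0 ?_) 2
        have hpos : 0 < 2 * c * τ ^ 2 := by positivity
        -- Off the event the exponent is at most `(Z/τ)² / 2`, so by monotonicity the random factor
        -- is dominated by a deterministic function of `ξ`.
        have h1 : c * Z ^ 2 / s ω ≤ c * Z ^ 2 / (2 * c * τ ^ 2) := by
          gcongr
          exact (not_le.1 hω).le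
        refine h1.trans_eq ?_
        rw [hZ]
        field_simp
    nlinarith [sq_nonneg (Z * shrink A (c * Z ^ 2 / s ω) + θ)]
  refine hle.trans ?_
  have hsum1 : Integrable (fun ω => 2 * θ ^ 2 + 2 * ((θ + τ * ξ ω) ^ 2 * B (s ω))) P :=
    (integrable_const _).add (hI1.const_mul 2)
  rw [integral_add hsum1 (hI2.const_mul 2), integral_add (integrable_const _) (hI1.const_mul 2),
    integral_const, probReal_univ, one_smul, integral_const_mul, integral_const_mul]
  linarith

end CoordinateRisk

/-! ### Summation over levels and comparison of rates. -/

section RateCalculus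

theorem sum_Ico_geometric_le (a b : ℕ) : ∑ j ∈ Finset.Ico a b, (√2)⁻¹ ^ j ≤ 4 * (√2)⁻¹ ^ a := by
  -- A rational bound on the ratio; `4` is `1 / (1 - 3/4)`.
  have h2 : (√2)⁻¹ ≤ 3 / 4 := by
    rw [inv_le_comm₀ (by positivity) (by norm_num)]
    exact Real.le_sqrt_of_sq_le (by norm_num)
  have h0 : 0 ≤ (√2)⁻¹ := by positivity
  set ρ := (√2)⁻¹
  have key : ∀ m : ℕ, ∑ j ∈ Finset.range m, ρ ^ (a + j) ≤ 4 * ρ ^ a - 4 * ρ ^ (a + m) := by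
    intro m
    induction m with
    | zero => simp
    | succ m ih =>
      rw [Finset.sum_range_succ, ← add_assoc, pow_succ]
      have : 0 ≤ ρ ^ (a + m) := by positivity
      nlinarith
  rw [Finset.sum_Ico_eq_sum_range]
  have := key (b - a)
  have h3 : 0 ≤ ρ ^ (a + (b - a)) := by positivity
  linarith

theorem sum_Ico_two_pow_le (a b : ℕ) : ∑ j ∈ Finset.Ico a b, (2 : ℝ) ^ j ≤ 2 ^ b := by
  have h : ∑ j ∈ Finset.Ico a b, (2 : ℝ) ^ j ≤ ∑ j ∈ Finset.range b, (2 : ℝ) ^ j := by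
    rw [Finset.range_eq_Ico]
    exact Finset.sum_le_sum_of_subset_of_nonneg (Finset.Ico_subset_Ico_left (Nat.zero_le a))
      fun _ _ _ => by positivity
  rw [geom_sum_eq (by norm_num)] at h
  linarith

/-- Here `p` and `q` stand for `V^{1/3}` and `D^{1/6}`, which makes all exponents integers. The two
terms cross at `2^j = (p/q)²`: the first grows geometrically up to there, the second decays
geometrically after it. -/
theorem sum_min_level_le {p q : ℝ} (hp : 0 ≤ p) (hq : 0 < q) (J : ℕ) :
    ∑ j ∈ Finset.Ico 1 J, min (2 ^ j * q ^ 6) (p ^ 3 * q ^ 3 * (√2)⁻¹ ^ j) ≤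
      6 * (p ^ 2 * q ^ 4) := by
  have hρ : (√2)⁻¹ ≤ 1 := inv_le_one_of_one_le₀ (Real.one_le_sqrt.2 (by norm_num))
  rcases le_total p q with hpq | hpq
  · have h1 : ∑ j ∈ Finset.Ico 1 J, min (2 ^ j * q ^ 6) (p ^ 3 * q ^ 3 * (√2)⁻¹ ^ j) ≤
        p ^ 3 * q ^ 3 * (4 * (√2)⁻¹ ^ 1) := by
      refine (Finset.sum_le_sum fun j _ => min_le_right _ _).trans ?_
      rw [← Finset.mul_sum]
      gcongr
      exact sum_Ico_geometric_le 1 J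
    have h2 : p ^ 3 * q ^ 3 ≤ p ^ 2 * q ^ 4 := by
      have : 0 ≤ p ^ 2 * q ^ 3 * (q - p) := mul_nonneg (by positivity) (by linarith)
      linarith
    have h3 : 0 ≤ p ^ 3 * q ^ 3 := by positivity
    rw [pow_one] at h1
    nlinarith
  · have hp0 : 0 < p := hq.trans_le hpq
    obtain ⟨m, hm1, hm2⟩ := exists_nat_pow_near (x := (p / q) ^ 2) (y := 2)
      (one_le_pow₀ ((one_le_div hq).2 hpq)) (by norm_num)
    -- The crossing level `m` may exceed `J`; extending the sum to `max J (m + 1)` covers both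
    -- cases.
    have hsplit : ∑ j ∈ Finset.Ico 1 J, min (2 ^ j * q ^ 6) (p ^ 3 * q ^ 3 * (√2)⁻¹ ^ j) ≤
        ∑ j ∈ Finset.Ico 1 (m + 1), 2 ^ j * q ^ 6 +
          ∑ j ∈ Finset.Ico (m + 1) (max J (m + 1)), p ^ 3 * q ^ 3 * (√2)⁻¹ ^ j := by
      have h1 : ∑ j ∈ Finset.Ico 1 J, min (2 ^ j * q ^ 6) (p ^ 3 * q ^ 3 * (√2)⁻¹ ^ j) ≤
          ∑ j ∈ Finset.Ico 1 (max J (m + 1)),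
            min (2 ^ j * q ^ 6) (p ^ 3 * q ^ 3 * (√2)⁻¹ ^ j) :=
        Finset.sum_le_sum_of_subset_of_nonneg (Finset.Ico_subset_Ico_right (le_max_left _ _))
          fun _ _ _ => by positivity
      refine h1.trans ?_
      rw [← Finset.sum_Ico_consecutive _ (by omega : 1 ≤ m + 1) (le_max_right J (m + 1))]
      exact add_le_add (Finset.sum_le_sum fun j _ => min_le_left _ _)
        (Finset.sum_le_sum fun j _ => min_le_right _ _)
    have hA : ∑ j ∈ Finset.Ico 1 (m + 1), 2 ^ j * q ^ 6 ≤ 2 * (p ^ 2 * q ^ 4) := by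
      rw [← Finset.sum_mul]
      calc (∑ j ∈ Finset.Ico 1 (m + 1), (2 : ℝ) ^ j) * q ^ 6
          ≤ 2 ^ (m + 1) * q ^ 6 := by
            gcongr
            exact sum_Ico_two_pow_le 1 (m + 1)
        _ = 2 * 2 ^ m * q ^ 6 := by ring
        _ ≤ 2 * (p / q) ^ 2 * q ^ 6 := by gcongr
        _ = 2 * (p ^ 2 * q ^ 4) := by field_simp
    have hB : ∑ j ∈ Finset.Ico (m + 1) (max J (m + 1)), p ^ 3 * q ^ 3 * (√2)⁻¹ ^ j ≤
        4 * (p ^ 2 * q ^ 4) := by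
      have hpow : (√2)⁻¹ ^ (m + 1) ≤ q / p := by
        refine (sq_le_sq₀ (by positivity) (by positivity)).1 ?_
        rw [← pow_mul, mul_comm (m + 1) 2, pow_mul, inv_pow, Real.sq_sqrt (by norm_num), inv_pow,
          inv_le_comm₀ (by positivity) (by positivity), ← inv_pow, inv_div]
        exact hm2.le
      rw [← Finset.mul_sum]
      calc p ^ 3 * q ^ 3 * ∑ j ∈ Finset.Ico (m + 1) (max J (m + 1)), (√2)⁻¹ ^ j
          ≤ p ^ 3 * q ^ 3 * (4 * (√2)⁻¹ ^ (m + 1)) := by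
            gcongr
            exact sum_Ico_geometric_le _ _
        _ ≤ p ^ 3 * q ^ 3 * (4 * (q / p)) := by gcongr
        _ = 4 * (p ^ 2 * q ^ 4) := by field_simp
    linarith

theorem rpow_two_thirds_le {x y : ℝ} (hx : 0 ≤ x) (hy : 0 ≤ y) (h : x ^ 2 ≤ y ^ 3) :
    x ^ ((2 : ℝ) / 3) ≤ y := by
  have h1 : x ^ ((2 : ℝ) / 3) = (x ^ 2) ^ ((1 : ℝ) / 3) := by
    rw [← Real.rpow_natCast x 2, ← Real.rpow_mul hx]
    norm_num
  have h2 : (y ^ 3) ^ ((1 : ℝ) / 3) = y := by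
    rw [← Real.rpow_natCast y 3, ← Real.rpow_mul hy]
    norm_num
  rw [h1, ← h2]
  exact Real.rpow_le_rpow (by positivity) h (by norm_num)

theorem sum_min_level_le_rpow {V D : ℝ} (hV : 0 ≤ V) (hD : 0 < D) (J : ℕ) :
    ∑ j ∈ Finset.Ico 1 J, min (2 ^ j * D) (V * √D * (√2)⁻¹ ^ j) ≤
      6 * (V * D) ^ ((2 : ℝ) / 3) := by
  set p := V ^ ((1 : ℝ) / 3) with hp
  set q := D ^ ((1 : ℝ) / 6) with hq
  have hp0 : 0 ≤ p := by positivity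
  have hq0 : 0 < q := by positivity
  have hp3 : p ^ 3 = V := by
    rw [hp, ← Real.rpow_natCast, ← Real.rpow_mul hV]
    norm_num
  have hq6 : q ^ 6 = D := by
    rw [hq, ← Real.rpow_natCast, ← Real.rpow_mul hD.le]
    norm_num
  have hq3 : q ^ 3 = √D := by
    rw [← hq6, show q ^ 6 = (q ^ 3) ^ 2 by ring, Real.sqrt_sq (by positivity)]
  have hpq : (V * D) ^ ((2 : ℝ) / 3) = p ^ 2 * q ^ 4 := by
    have h1 : V * D = (p * q ^ 2) ^ 3 := by rw [← hp3, ← hq6]; ring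
    rw [h1, ← Real.rpow_natCast, ← Real.rpow_mul (by positivity)]
    norm_num
    ring
  rw [hpq]
  have := sum_min_level_le hp0 hq0 J
  rwa [hp3, hq6, hq3] at this

theorem log_le_two_mul_sqrt {N : ℝ} (hN : 0 < N) : Real.log N ≤ 2 * √N := by
  have h1 := Real.log_le_sub_one_of_pos (Real.sqrt_pos.2 hN)
  rw [Real.log_sqrt hN.le] at h1
  linarith

/-- The contribution of the levels to the risk, in terms of the three terms of the rate. -/
theorem rpow_two_thirds_bound {V σ N β : ℝ} (hV : 0 ≤ V) (hσ : 0 < σ) (hN : 1 ≤ N)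
    (hβ : 0 < β) (hβ1 : β ≤ 1) :
    (V * ((σ ^ 2 + 2 * V ^ 2 / N) * Real.log N / (N * β))) ^ ((2 : ℝ) / 3) ≤
      1 / β * ((V * σ ^ 2 * Real.log N / N) ^ ((2 : ℝ) / 3) + 4 * (V ^ 2 / N)) := by
  have hN0 : 0 < N := by linarith
  have hL : 0 ≤ Real.log N := Real.log_nonneg hN
  have hL2 : Real.log N ^ 2 ≤ 4 * N := by
    have h1 := log_le_two_mul_sqrt hN0
    calc Real.log N ^ 2 ≤ (2 * √N) ^ 2 := by gcongr
      _ = 4 * N := by rw [mul_pow, Real.sq_sqrt hN0.le]; norm_num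
  set a := V * σ ^ 2 * Real.log N / N with ha
  -- The part due to the bias of `σ̂²`; `(log N)² ≤ 4N` absorbs it into `V²/N`.
  set b := 2 * V ^ 3 * Real.log N / N ^ 2 with hb
  have ha0 : 0 ≤ a := by positivity
  have hb0 : 0 ≤ b := by positivity
  have h1 : V * ((σ ^ 2 + 2 * V ^ 2 / N) * Real.log N / (N * β)) = (a + b) / β := by
    rw [ha, hb]
    field_simp
  have h2 : (a + b) ^ ((2 : ℝ) / 3) ≤ a ^ ((2 : ℝ) / 3) + b ^ ((2 : ℝ) / 3) :=
    Real.rpow_add_le_add_rpow ha0 hb0 (by norm_num) (by norm_num)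
  have h3 : b ^ ((2 : ℝ) / 3) ≤ 4 * (V ^ 2 / N) := by
    refine rpow_two_thirds_le hb0 (by positivity) ?_
    rw [hb, show (2 * V ^ 3 * Real.log N / N ^ 2) ^ 2 =
      4 * V ^ 6 / N ^ 4 * Real.log N ^ 2 by ring]
    calc 4 * V ^ 6 / N ^ 4 * Real.log N ^ 2 ≤ 4 * V ^ 6 / N ^ 4 * (4 * N) := by gcongr
      _ = 16 * (V ^ 6 / N ^ 3) := by field_simp; ring
      _ ≤ 64 * (V ^ 6 / N ^ 3) := by
        have : 0 ≤ V ^ 6 / N ^ 3 := by positivity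
        linarith
      _ = (4 * (V ^ 2 / N)) ^ 3 := by ring
  -- The factor `β^{-2/3}` is weakened to `1/β`, which is where `β ≤ 1` is needed.
  have h4 : β ≤ β ^ ((2 : ℝ) / 3) := by
    have := Real.rpow_le_rpow_of_exponent_ge hβ hβ1 (by norm_num : (2 : ℝ) / 3 ≤ 1)
    rwa [Real.rpow_one] at this
  rw [h1, Real.div_rpow (by positivity) hβ.le, div_eq_inv_mul, ← one_div]
  have h5 : 1 / β ^ ((2 : ℝ) / 3) ≤ 1 / β := one_div_le_one_div_of_le hβ h4
  refine mul_le_mul h5 (by linarith) (by positivity) (by positivity)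

end RateCalculus

/-! ### The oracle inequality in the Gaussian sequence model. -/

section SequenceModel

variable {Ω : Type*} [MeasurableSpace Ω] {P : Measure Ω} {κ : Type*} {ξ : κ → Ω → ℝ}

/-- The Gaussian law has no atoms, so one nonvanishing coordinate suffices; the bound by the
threshold divides by this sum. -/
theorem ae_sum_sq_pos (hξ : ∀ a, HasLaw (ξ a) (gaussianReal 0 1) P) {T : Finset κ}
    (hT : T.Nonempty) (θ : κ → ℝ) {τ : ℝ} (hτ : 0 < τ) :
    ∀ᵐ ω ∂P, 0 < 2 * ∑ b ∈ T, (θ b + τ * ξ b ω) ^ 2 := by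
  obtain ⟨b, hb⟩ := hT
  have h1 : ∀ᵐ z ∂gaussianReal 0 1, z ≠ -θ b / τ := by
    have := nullSingletonClass_gaussianReal (μ := 0) (v := 1) one_ne_zero
    rw [ae_iff]
    simp
  have h2 : ∀ᵐ ω ∂P, ξ b ω ≠ -θ b / τ := by
    rw [← (hξ b).map_eq] at h1
    exact ae_of_ae_map (hξ b).aemeasurable h1
  filter_upwards [h2] with ω hω
  have h3 : θ b + τ * ξ b ω ≠ 0 := by
    intro h
    apply hω
    field_simp
    linarith
  have h4 : 0 < (θ b + τ * ξ b ω) ^ 2 := by positivity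
  have h5 : (θ b + τ * ξ b ω) ^ 2 ≤ ∑ b ∈ T, (θ b + τ * ξ b ω) ^ 2 :=
    Finset.single_le_sum (f := fun b => (θ b + τ * ξ b ω) ^ 2) (fun _ _ => sq_nonneg _) hb
  linarith

theorem indepFun_sum_sq (hξ : ∀ a, AEMeasurable (ξ a) P) (hind : iIndepFun ξ P)
    {T : Finset κ} {a : κ} (ha : a ∉ T) (θ : κ → ℝ) (τ : ℝ) :
    IndepFun (ξ a) (fun ω => 2 * ∑ b ∈ T, (θ b + τ * ξ b ω) ^ 2) P := by
  have h := hind.indepFun_finset₀ {a} T (Finset.disjoint_singleton_left.2 ha) hξ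
  have hφ : Measurable fun z : ({a} : Finset κ) → ℝ => z ⟨a, Finset.mem_singleton_self a⟩ :=
    measurable_pi_apply _
  have hψ : Measurable fun z : T → ℝ => 2 * ∑ b : T, (θ b + τ * z b) ^ 2 := by fun_prop
  have h2 := h.comp hφ hψ
  refine h2.congr (Filter.EventuallyEq.rfl) (Filter.Eventually.of_forall fun ω => ?_)
  simp only [Function.comp_apply]
  rw [Finset.sum_coe_sort T (fun b => (θ b + τ * ξ b ω) ^ 2)]

variable [IsProbabilityMeasure P]

theorem integrable_sum_sq (hξ : ∀ a, HasLaw (ξ a) (gaussianReal 0 1) P) (T : Finset κ)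
    (θ : κ → ℝ) (τ : ℝ) : Integrable (fun ω => 2 * ∑ b ∈ T, (θ b + τ * ξ b ω) ^ 2) P :=
  (integrable_finsetSum T fun b _ => integrable_sq_affine (hξ b) (θ b) τ).const_mul 2

theorem integral_sum_sq (hξ : ∀ a, HasLaw (ξ a) (gaussianReal 0 1) P) (T : Finset κ)
    (θ : κ → ℝ) {τ : ℝ} (hτ : 0 < τ) :
    ∫ ω, 2 * ∑ b ∈ T, (θ b + τ * ξ b ω) ^ 2 ∂P = 2 * (∑ b ∈ T, θ b ^ 2 + T.card * τ ^ 2) := by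
  rw [integral_const_mul, integral_finsetSum T fun b _ => integrable_sq_affine (hξ b) (θ b) τ,
    Finset.sum_congr rfl fun b _ => integral_sq_affine (hξ b) (θ b) hτ, Finset.sum_add_distrib,
    Finset.sum_const, nsmul_eq_mul]

theorem phiInv_mem {y : ℝ} (hy : 0 < y) : phiInv y ∈ Set.Ioo (0 : ℝ) 1 :=
  phi_bijOn.surjOn.mapsTo_invFunOn hy

theorem phi_phiInv {y : ℝ} (hy : 0 < y) : phi (phiInv y) = y :=
  phi_bijOn.surjOn.rightInvOn_invFunOn hy

/-- With `N/2` residual degrees of freedom, the variance estimator falls below `2βσ²` with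
probability at most `2/N`. -/
theorem measure_sum_sq_le_two_div (hξ : ∀ a, HasLaw (ξ a) (gaussianReal 0 1) P)
    (hind : iIndepFun ξ P) {T : Finset κ} {N : ℝ} (hN : 2 < N) (hT : (T.card : ℝ) = N / 2)
    (θ : κ → ℝ) {τ : ℝ} (hτ : 0 < τ) {β : ℝ}
    (hβ : β ≤ 1 / 2 * phiInv (2 * Real.log (N / 2) / N)) :
    P.real {ω | 2 * ∑ b ∈ T, (θ b + τ * ξ b ω) ^ 2 ≤ 2 * (N * β) * τ ^ 2} ≤ 2 / N := by
  have hN0 : 0 < N := by linarith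
  have hy : 0 < 2 * Real.log (N / 2) / N := by
    have := Real.log_pos (by linarith : 1 < N / 2)
    positivity
  obtain ⟨hx0, hx1⟩ := phiInv_mem hy
  -- The Chernoff bound is taken at `x = φ⁻¹(2 log (N/2) / N)`: its exponent `(N/2) φ(x)` is `log
  -- (N/2)`, and the hypothesis on `β` reads `Nβ ≤ (N/2) x`.
  have h := measure_sum_sq_le hξ hind T (fun b => θ b / τ) hx0 hx1
  rw [phi_phiInv hy, hT] at h
  have h2 : Real.exp (-(N / 2 * (2 * Real.log (N / 2) / N))) = 2 / N := by
    rw [show N / 2 * (2 * Real.log (N / 2) / N) = Real.log (N / 2) by field_simp, Real.exp_neg,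
      Real.exp_log (by positivity), inv_div]
  rw [h2] at h
  refine (measureReal_mono fun ω hω => ?_).trans h
  rw [Set.mem_ofPred_eq] at hω ⊢
  have h3 : ∀ b, (θ b + τ * ξ b ω) ^ 2 = τ ^ 2 * (θ b / τ + ξ b ω) ^ 2 := fun b => by
    field_simp
  simp_rw [h3, ← Finset.mul_sum] at hω
  have hτ2 : 0 < τ ^ 2 := by positivity
  have h4 : ∑ b ∈ T, (θ b / τ + ξ b ω) ^ 2 ≤ N * β := by
    refine le_of_mul_le_mul_left ?_ hτ2
    linarith
  refine h4.trans ?_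
  nlinarith

/-- The constant in the oracle inequality for the coordinates. -/
def oracleConst : ℝ := 3 + 16 * Real.exp (9 / 2)

theorem five_le_oracleConst : 5 ≤ oracleConst := by
  have : 1 ≤ Real.exp (9 / 2) := Real.one_le_exp (by norm_num)
  rw [oracleConst]
  linarith

theorem two_le_log {N : ℝ} (hN : 8 ≤ N) : 2 ≤ Real.log N := by
  have h1 : Real.log 8 ≤ Real.log N := Real.log_le_log (by norm_num) hN
  have h2 : Real.log 8 = 3 * Real.log 2 := by
    rw [show (8 : ℝ) = 2 ^ 3 by norm_num, Real.log_pow]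
    norm_num
  have := Real.log_two_gt_d9
  linarith

/-- The oracle inequality for one coordinate. -/
theorem integral_coordinate_risk_le (hξ : ∀ a, HasLaw (ξ a) (gaussianReal 0 1) P)
    (hind : iIndepFun ξ P) {T : Finset κ} {a : κ} (ha : a ∉ T) {N : ℝ} (hN : 8 ≤ N)
    (hT : (T.card : ℝ) = N / 2) (θ : κ → ℝ) {σ β W : ℝ} (hσ : 0 < σ) (hβ0 : 0 < β)
    (hβ : β ≤ 1 / 2 * phiInv (2 * Real.log (N / 2) / N)) (hW : ∑ b ∈ T, θ b ^ 2 ≤ W) :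
    ∫ ω, ((θ a + σ / √N * ξ a ω) * shrink (Real.exp 1 * N / 2)
        (N * β * (θ a + σ / √N * ξ a ω) ^ 2 /
          (2 * ∑ b ∈ T, (θ b + σ / √N * ξ b ω) ^ 2)) - θ a) ^ 2 ∂P ≤
      oracleConst * min ((σ ^ 2 + 2 * W) * Real.log N / (N * β)) (θ a ^ 2) +
        8 * Real.log N * σ ^ 2 / N ^ 2 := by
  have hN0 : 0 < N := by linarith
  set τ := σ / √N with hτdef
  have hτ : 0 < τ := by positivity
  have hτ2 : τ ^ 2 = σ ^ 2 / N := by rw [hτdef, div_pow, Real.sq_sqrt hN0.le]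
  set A := Real.exp 1 * N / 2 with hAdef
  set L := Real.log N with hL
  have hL2 : 2 ≤ L := two_le_log hN
  have hA : Real.exp 1 ≤ A := by
    rw [hAdef]
    nlinarith [Real.exp_pos 1]
  have hA1 : 1 ≤ A := (Real.one_le_exp (by norm_num)).trans hA
  have hlogA : Real.log A ≤ 1 + L := by
    have h1 : A ≤ Real.exp 1 * N := by
      rw [hAdef]
      nlinarith [Real.exp_pos 1]
    have h2 := Real.log_le_log (by linarith) h1
    rwa [Real.log_mul (Real.exp_pos 1).ne' hN0.ne', Real.log_exp] at h2
  have hTne : T.Nonempty := by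
    rw [← Finset.card_pos]
    have : (0 : ℝ) < T.card := by rw [hT]; positivity
    exact_mod_cast this
  have hy : 0 < 2 * Real.log (N / 2) / N := by
    have := Real.log_pos (by linarith : 1 < N / 2)
    positivity
  have hβ2 : β ≤ 1 / 2 := by
    have := (phiInv_mem hy).2
    linarith
  have hs := integrable_sum_sq hξ T θ τ
  have hW0 : 0 ≤ W := (Finset.sum_nonneg fun b _ => sq_nonneg (θ b)).trans hW
  have hD0 : 0 < (σ ^ 2 + 2 * W) * L / (N * β) := by positivity
  have hK := five_le_oracleConst
  have hleak : 0 ≤ 8 * L * σ ^ 2 / N ^ 2 := by positivity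
  rcases min_choice ((σ ^ 2 + 2 * W) * L / (N * β)) (θ a ^ 2) with hmin | hmin
  · rw [hmin]
    have h1 := integral_shrink_risk_le_threshold (hξ a) hs (ae_sum_sq_pos hξ hTne θ hτ) hA1 (θ a)
      hτ (by positivity : 0 < N * β)
    rw [integral_sum_sq hξ T θ hτ, hT, hτ2] at h1
    have h2 : 2 * (∑ b ∈ T, θ b ^ 2 + N / 2 * (σ ^ 2 / N)) ≤ σ ^ 2 + 2 * W := by
      rw [show N / 2 * (σ ^ 2 / N) = σ ^ 2 / 2 by field_simp]
      linarith
    have h3 : 2 * (Real.log A + 1) / (N * β) * (2 * (∑ b ∈ T, θ b ^ 2 + N / 2 * (σ ^ 2 / N))) ≤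
        4 * ((σ ^ 2 + 2 * W) * L / (N * β)) := by
      have h4 : 2 * (Real.log A + 1) / (N * β) ≤ 4 * L / (N * β) := by
        gcongr ?_ / _
        linarith
      calc _ ≤ 4 * L / (N * β) * (σ ^ 2 + 2 * W) := by
            refine mul_le_mul h4 h2 ?_ (by positivity)
            have : 0 ≤ ∑ b ∈ T, θ b ^ 2 := Finset.sum_nonneg fun b _ => sq_nonneg (θ b)
            positivity
        _ = _ := by ring
    -- The noise term costs one more multiple of the first argument of the minimum, so five in all,
    -- as in `five_le_oracleConst`.
    have h5 : 2 * (σ ^ 2 / N) ≤ (σ ^ 2 + 2 * W) * L / (N * β) := by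
      rw [← mul_div_assoc, div_le_div_iff₀ hN0 (by positivity)]
      have h6 : 2 * σ ^ 2 * β ≤ (σ ^ 2 + 2 * W) * L := by
        have h7 : 2 * σ ^ 2 * β ≤ σ ^ 2 := by nlinarith [sq_nonneg σ]
        nlinarith [sq_nonneg σ]
      nlinarith
    nlinarith
  · rw [hmin]
    have hq := measure_sum_sq_le_two_div hξ hind (by linarith : 2 < N) hT θ hτ hβ
    have h1 := integral_shrink_risk_le_signal (hξ a) hs.aemeasurable
      (indepFun_sum_sq (fun b => (hξ b).aemeasurable) hind ha θ τ) hA (θ a) hτ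
      (by positivity : 0 < N * β) hq
    refine h1.trans ?_
    rw [hτ2]
    have h2 : Real.exp 1 * Real.log A / A = 2 * Real.log A / N := by
      rw [hAdef]
      field_simp
    -- The coefficient of `θ²` is `2 + 2 * (1/4) + 16 exp (9/2)`, below `oracleConst`; the terms
    -- free of `θ` form the remainder.
    rw [h2, oracleConst]
    have h3 : 2 / N ≤ 1 / 4 := by
      rw [div_le_div_iff₀ hN0 (by norm_num)]
      linarith
    have h4 : 2 / N * (θ a ^ 2 + σ ^ 2 / N) ≤ 1 / 4 * θ a ^ 2 + 2 * σ ^ 2 / N ^ 2 := by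
      have : 2 / N * (θ a ^ 2 + σ ^ 2 / N) = 2 / N * θ a ^ 2 + 2 * σ ^ 2 / N ^ 2 := by ring
      rw [this]
      gcongr
    have h5 : σ ^ 2 / N * (2 * Real.log A / N) ≤ 2 * (1 + L) * σ ^ 2 / N ^ 2 := by
      have : σ ^ 2 / N * (2 * Real.log A / N) = 2 * Real.log A * σ ^ 2 / N ^ 2 := by ring
      rw [this]
      gcongr
    have h6 : 2 * (2 * σ ^ 2 / N ^ 2) + 2 * (2 * (1 + L) * σ ^ 2 / N ^ 2) ≤
        8 * L * σ ^ 2 / N ^ 2 := by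
      have h7 : 0 ≤ σ ^ 2 / N ^ 2 := by positivity
      have h8 : 8 * L * σ ^ 2 / N ^ 2 -
          (2 * (2 * σ ^ 2 / N ^ 2) + 2 * (2 * (1 + L) * σ ^ 2 / N ^ 2)) =
          4 * (L - 2) * (σ ^ 2 / N ^ 2) := by ring
      have h9 : 0 ≤ 4 * (L - 2) * (σ ^ 2 / N ^ 2) := mul_nonneg (by linarith) h7
      linarith
    linarith [sq_nonneg (θ a)]

end SequenceModel

/-! ### Risk of the Haar estimator. -/

section HaarRisk

/-- Parseval in the full basis; the estimator has no component on level `J`, whose signal energy is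
therefore a deterministic bias. -/
theorem haarLoss_eq {J : ℕ} (hJ : 1 ≤ J) (β : ℝ) (μ y : EuclideanSpace ℝ (Fin (2 ^ J))) :
    haarLoss J β μ y = ∑ a ∈ haarIndex J,
      (empInner y (haarVec J a) * shrink (Real.exp 1 * 2 ^ J / 2)
        (2 ^ J * β * empInner y (haarVec J a) ^ 2 / haarVariance J y) -
          empInner μ (haarVec J a)) ^ 2 + ∑ a ∈ haarLevel J, empInner μ (haarVec J a) ^ 2 := by
  have hO := empOrthonormal_haarVec J
  rw [haarLoss, haarEstimator_eq_haarShrinkage hJ, hO.parseval (by positivity)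
    (card_haarIndex_succ J), haarIndex_succ, Finset.sum_union (disjoint_haarLevel_haarIndex J),
    add_comm]
  congr 1
  · refine Finset.sum_congr rfl fun a ha => ?_
    rw [empInner_sub_left, haarShrinkage, (hO.mono (haarIndex_subset_succ J)).empInner_sum _ ha,
      shrink, ← mul_div_assoc, sub_sq_comm]
  · refine Finset.sum_congr rfl fun a ha => ?_
    rw [empInner_sub_left, haarShrinkage, empInner_sum_left, Finset.sum_eq_zero, sub_zero]
    intro b hb
    rw [empInner_smul_left, hO.2 b (haarIndex_subset_succ J hb) a (haarLevel_subset_succ J ha),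
      mul_zero]
    rintro rfl
    exact (fst_lt_of_mem_haarIndex hb).ne (fst_eq_of_mem_haarLevel ha)

theorem sum_haarIndex_eq (J : ℕ) (hJ : 1 ≤ J) (F : ℕ × ℕ → ℝ) :
    ∑ a ∈ haarIndex J, F a = F (0, 0) + ∑ j ∈ Finset.Ico 1 J, ∑ a ∈ haarLevel j, F a := by
  rw [haarIndex, Finset.sum_biUnion]
  · rw [Finset.range_eq_Ico, Finset.sum_eq_sum_Ico_succ_bot (by omega)]
    simp [haarLevel]
  · intro i _ j _ hij
    exact Finset.disjoint_left.2 fun a ha hb =>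
      hij ((fst_eq_of_mem_haarLevel ha).symm.trans (fst_eq_of_mem_haarLevel hb))

/-- A minimum is at most the geometric mean; this brings in the `ℓ¹` norm, which the variation
controls. -/
theorem min_sq_le_sqrt_mul_abs {D : ℝ} (hD : 0 ≤ D) (t : ℝ) : min D (t ^ 2) ≤ √D * |t| := by
  rcases le_total (√D) |t| with h | h
  · refine (min_le_left _ _).trans ?_
    nlinarith [Real.mul_self_sqrt hD, Real.sqrt_nonneg D]
  · refine (min_le_right _ _).trans ?_
    rw [← sq_abs]
    nlinarith [abs_nonneg t]

variable {J : ℕ} {x : Fin (2 ^ J + 1) → ℝ} {f : ℝ → ℝ}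

theorem sum_min_empInner_signal_le (hJ : 1 ≤ J) (hx : StrictMono x) (hx0 : x 0 = 0)
    (hx1 : x (Fin.last (2 ^ J)) = 1) (hf : BoundedVariationOn f (Set.Icc 0 1)) {D : ℝ}
    (hD : 0 < D) :
    ∑ a ∈ haarIndex J, min D (empInner (signal f x) (haarVec J a) ^ 2) ≤
      D + 6 * (totalVariation f * D) ^ ((2 : ℝ) / 3) := by
  rw [sum_haarIndex_eq J hJ]
  -- The variation says nothing about the mean of the signal, so the coefficient `(0, 0)` is charged
  -- the full `D`.
  refine add_le_add (min_le_left _ _) ?_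
  refine le_trans ?_ (sum_min_level_le_rpow (totalVariation_nonneg f) hD J)
  refine Finset.sum_le_sum fun j hj => ?_
  rw [Finset.mem_Ico] at hj
  refine le_min ?_ ?_
  · refine (Finset.sum_le_sum fun a _ => min_le_left _ _).trans ?_
    obtain ⟨i, rfl⟩ : ∃ i, j = i + 1 := ⟨j - 1, by omega⟩
    rw [Finset.sum_const, nsmul_eq_mul, card_haarLevel_succ, pow_succ]
    push_cast
    have : (0 : ℝ) < 2 ^ i * D := by positivity
    linarith
  · refine (Finset.sum_le_sum fun a _ => min_sq_le_sqrt_mul_abs hD.le _).trans ?_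
    rw [← Finset.mul_sum]
    have h := sum_abs_empInner_signal_le (by omega) hj.2.le hx hx0 hx1 hf
    calc _ ≤ √D * (totalVariation f * (√2)⁻¹ ^ j) := by gcongr
      _ = _ := by ring

theorem sum_sq_empInner_signal_le (hJ : 1 ≤ J) (hx : StrictMono x) (hx0 : x 0 = 0)
    (hx1 : x (Fin.last (2 ^ J)) = 1) (hf : BoundedVariationOn f (Set.Icc 0 1)) :
    ∑ a ∈ haarLevel J, empInner (signal f x) (haarVec J a) ^ 2 ≤
      totalVariation f ^ 2 / 2 ^ J := by
  have h := sum_abs_empInner_signal_le (by omega) le_rfl hx hx0 hx1 hf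
  have h1 : ∑ a ∈ haarLevel J, empInner (signal f x) (haarVec J a) ^ 2 ≤
      (∑ a ∈ haarLevel J, |empInner (signal f x) (haarVec J a)|) ^ 2 := by
    simp_rw [← sq_abs (empInner (signal f x) (haarVec J _))]
    exact Finset.sum_sq_le_sq_sum_of_nonneg fun a _ => abs_nonneg _
  refine h1.trans ((pow_le_pow_left₀ (Finset.sum_nonneg fun a _ => abs_nonneg _) h 2).trans_eq ?_)
  rw [mul_pow, ← pow_mul, mul_comm J 2, pow_mul, inv_pow, Real.sq_sqrt (by norm_num), inv_pow,
    div_eq_mul_inv]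

theorem empInner_observation (μ : EuclideanSpace ℝ (Fin (2 ^ J))) (σ : ℝ) {Ω : Type*}
    (ε : Fin (2 ^ J) → Ω → ℝ) (ω : Ω) (v : EuclideanSpace ℝ (Fin (2 ^ J))) :
    empInner (observation μ σ ε ω) v =
      empInner μ v + σ / √(2 ^ J) * ∑ i, v i / √(2 ^ J) * ε i ω := by
  have hN : (0 : ℝ) < 2 ^ J := by positivity
  have hs : √((2 : ℝ) ^ J) * √(2 ^ J) = 2 ^ J := Real.mul_self_sqrt hN.le
  simp only [empInner, observation]
  rw [Finset.mul_sum, Finset.mul_sum, Finset.mul_sum, ← Finset.sum_add_distrib]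
  refine Finset.sum_congr rfl fun i _ => ?_
  push_cast
  rw [show σ / √(2 ^ J) * (v i / √(2 ^ J) * ε i ω) =
    σ * v i * ε i ω / (√(2 ^ J) * √(2 ^ J)) by ring, hs]
  ring

theorem integral_haarLoss_le {Ω : Type*} [MeasurableSpace Ω] {P : Measure Ω}
    [IsProbabilityMeasure P] (hJ : 3 ≤ J) {β : ℝ} (hβ0 : 0 < β)
    (hβ : β ≤ 1 / 2 * phiInv (2 * Real.log ((2 : ℝ) ^ J / 2) / (2 : ℝ) ^ J))
    (hx : StrictMono x) (hx0 : x 0 = 0) (hx1 : x (Fin.last (2 ^ J)) = 1) {σ : ℝ} (hσ : 0 < σ)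
    {ε : Fin (2 ^ J) → Ω → ℝ} (hε : ∀ i, HasLaw (ε i) (gaussianReal 0 1) P)
    (hind : iIndepFun ε P) (hf : BoundedVariationOn f (Set.Icc 0 1)) :
    Integrable (fun ω => haarLoss J β (signal f x) (observation (signal f x) σ ε ω)) P ∧
      ∫ ω, haarLoss J β (signal f x) (observation (signal f x) σ ε ω) ∂P ≤
        oracleConst * ∑ a ∈ haarIndex J, min ((σ ^ 2 + 2 * totalVariation f ^ 2 / 2 ^ J) *
          Real.log (2 ^ J) / (2 ^ J * β)) (empInner (signal f x) (haarVec J a) ^ 2) +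
        4 * (σ ^ 2 * Real.log (2 ^ J) / 2 ^ J) + totalVariation f ^ 2 / 2 ^ J := by
  have hJ1 : 1 ≤ J := by omega
  have hN8 : (8 : ℝ) ≤ 2 ^ J := by
    calc (8 : ℝ) = 2 ^ 3 := by norm_num
      _ ≤ 2 ^ J := pow_le_pow_right₀ (by norm_num) hJ
  have hN0 : (0 : ℝ) < 2 ^ J := by positivity
  have hO := empOrthonormal_haarVec J
  set N : ℝ := 2 ^ J with hN
  set μ := signal f x with hμ
  set κ := {a // a ∈ haarIndex (J + 1)}
  let θ : κ → ℝ := fun a => empInner μ (haarVec J a.1)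
  let w : κ → Fin (2 ^ J) → ℝ := fun a i => haarVec J a.1 i / √N
  let ξ : κ → Ω → ℝ := fun a ω => ∑ i, w a i * ε i ω
  have hww : ∀ a b : κ, ∑ i, w a i * w b i = empInner (haarVec J a.1) (haarVec J b.1) := by
    intro a b
    rw [empInner, Finset.mul_sum]
    refine Finset.sum_congr rfl fun i _ => ?_
    simp only [w]
    rw [div_mul_div_comm, Real.mul_self_sqrt hN0.le]
    push_cast
    rw [← hN]
    ring
  obtain ⟨hξ, hξind⟩ := orthonormal_linear_forms hε hind w
    (fun a => by rw [hww, hO.1 a.1 a.2])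
    (fun a b hab => by rw [hww, hO.2 a.1 a.2 b.1 b.2 fun e => hab (Subtype.ext e)])
  change ∀ a, HasLaw (ξ a) (gaussianReal 0 1) P at hξ
  change iIndepFun ξ P at hξind
  -- The level `J`, as a set of indices of the full basis, carries the residual degrees of freedom.
  let T : Finset κ := (haarLevel J).subtype (· ∈ haarIndex (J + 1))
  have hTsum : ∀ F : ℕ × ℕ → ℝ, ∑ b ∈ T, F b.1 = ∑ a ∈ haarLevel J, F a := fun F =>
    Finset.sum_subtype_of_mem F fun a ha => haarLevel_subset_succ J ha
  have hTcard : (T.card : ℝ) = N / 2 := by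
    have h1 := hTsum fun _ => 1
    rw [Finset.sum_const, Finset.sum_const, nsmul_eq_mul, nsmul_eq_mul, mul_one, mul_one] at h1
    obtain ⟨I, rfl⟩ : ∃ I, J = I + 1 := ⟨J - 1, by omega⟩
    rw [h1, card_haarLevel_succ, hN, pow_succ]
    push_cast
    ring
  have hZ : ∀ (a : κ) (ω : Ω), empInner (observation μ σ ε ω) (haarVec J a.1) =
      θ a + σ / √N * ξ a ω := fun a ω => empInner_observation μ σ ε ω _
  have hs : ∀ ω, haarVariance J (observation μ σ ε ω) =
      2 * ∑ b ∈ T, (θ b + σ / √N * ξ b ω) ^ 2 := by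
    intro ω
    rw [haarVariance_eq_sum, ← hTsum]
    simp_rw [hZ]
  have hW : ∑ b ∈ T, θ b ^ 2 ≤ totalVariation f ^ 2 / N := by
    rw [hTsum fun a => empInner μ (haarVec J a) ^ 2]
    exact sum_sq_empInner_signal_le hJ1 hx hx0 hx1 hf
  let R : ℕ × ℕ → Ω → ℝ := fun a ω =>
    (empInner (observation μ σ ε ω) (haarVec J a) * shrink (Real.exp 1 * N / 2)
      (N * β * empInner (observation μ σ ε ω) (haarVec J a) ^ 2 /
        haarVariance J (observation μ σ ε ω)) - empInner μ (haarVec J a)) ^ 2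
  have hloss : ∀ ω, haarLoss J β μ (observation μ σ ε ω) =
      ∑ a ∈ haarIndex J, R a ω + ∑ a ∈ haarLevel J, empInner μ (haarVec J a) ^ 2 :=
    fun ω => haarLoss_eq hJ1 β μ _
  have hR : ∀ a : κ, R a.1 = fun ω => ((θ a + σ / √N * ξ a ω) * shrink (Real.exp 1 * N / 2)
      (N * β * (θ a + σ / √N * ξ a ω) ^ 2 /
        (2 * ∑ b ∈ T, (θ b + σ / √N * ξ b ω) ^ 2)) - θ a) ^ 2 := by
    intro a
    ext ω
    simp only [R]
    rw [hZ, hs]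
  have hRint : ∀ a ∈ haarIndex J, Integrable (R a) P := by
    intro a ha
    have h := hR ⟨a, haarIndex_subset_succ J ha⟩
    simp only at h
    rw [h]
    exact integrable_shrink_risk (hξ _) (integrable_sum_sq hξ T θ _).aemeasurable (by positivity)
      _ _ _
  have hRle : ∀ a ∈ haarIndex J, ∫ ω, R a ω ∂P ≤
      oracleConst * min ((σ ^ 2 + 2 * totalVariation f ^ 2 / N) * Real.log N / (N * β))
        (empInner μ (haarVec J a) ^ 2) + 8 * Real.log N * σ ^ 2 / N ^ 2 := by
    intro a ha
    have h := hR ⟨a, haarIndex_subset_succ J ha⟩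
    simp only at h
    rw [h]
    have haT : (⟨a, haarIndex_subset_succ J ha⟩ : κ) ∉ T := fun hmem =>
      (fst_lt_of_mem_haarIndex ha).ne (fst_eq_of_mem_haarLevel (Finset.mem_subtype.1 hmem))
    have h2 := integral_coordinate_risk_le hξ hξind haT hN8 hTcard θ hσ hβ0 hβ hW
    rwa [← mul_div_assoc] at h2
  have hI : Integrable (fun ω => ∑ a ∈ haarIndex J, R a ω) P := integrable_finsetSum _ hRint
  simp_rw [hloss]
  refine ⟨hI.add (integrable_const _), ?_⟩
  rw [integral_add hI (integrable_const _), integral_const, probReal_univ, one_smul,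
    integral_finsetSum _ hRint]
  refine add_le_add ((Finset.sum_le_sum hRle).trans_eq ?_)
    (sum_sq_empInner_signal_le hJ1 hx hx0 hx1 hf)
  have hcard : ((haarIndex J).card : ℝ) = N / 2 := by
    obtain ⟨I, rfl⟩ : ∃ I, J = I + 1 := ⟨J - 1, by omega⟩
    rw [card_haarIndex_succ, hN, pow_succ]
    push_cast
    ring
  -- The `N/2` remainders `8 σ² log N / N²` add up to `4 σ² log N / N`.
  rw [Finset.sum_add_distrib, ← Finset.mul_sum, Finset.sum_const, nsmul_eq_mul, hcard]
  congr 1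
  field_simp
  ring

end HaarRisk

end HaarMix

end

/-! ### Assembly of the rate. -/

theorem corollary1 :
    ∃ C : ℝ, 0 < C ∧
      ∀ (J : ℕ), 3 ≤ J →
      ∀ (β : ℝ), 0 < β →
        β ≤ 1 / 2 * HaarMix.phiInv (2 * Real.log ((2 : ℝ) ^ J / 2) / (2 : ℝ) ^ J) →
        (∀ y : EuclideanSpace ℝ (Fin (2 ^ J)),
          HaarMix.haarEstimator J β y = HaarMix.haarShrinkage J β y) ∧
        ∀ (x : Fin (2 ^ J + 1) → ℝ), StrictMono x → x 0 = 0 → x (Fin.last (2 ^ J)) = 1 →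
        ∀ (σ : ℝ), 0 < σ →
        ∀ (Ω : Type*) [MeasurableSpace Ω] (P : Measure Ω) [IsProbabilityMeasure P]
          (ε : Fin (2 ^ J) → Ω → ℝ),
          (∀ i, HasLaw (ε i) (gaussianReal 0 1) P) → iIndepFun ε P →
        ∀ (f : ℝ → ℝ), BoundedVariationOn f (Set.Icc 0 1) →
          Integrable (fun ω => HaarMix.haarLoss J β (HaarMix.signal f x)
            (HaarMix.observation (HaarMix.signal f x) σ ε ω)) P ∧
          ∫ ω, HaarMix.haarLoss J β (HaarMix.signal f x)
              (HaarMix.observation (HaarMix.signal f x) σ ε ω) ∂P ≤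
            C / β *
              max ((HaarMix.totalVariation f * σ ^ 2 * Real.log ((2 : ℝ) ^ J) / (2 : ℝ) ^ J) ^
                  ((2 : ℝ) / 3))
                (max (HaarMix.totalVariation f ^ 2 / (2 : ℝ) ^ J)
                  (σ ^ 2 * Real.log ((2 : ℝ) ^ J) / (2 : ℝ) ^ J)) := by
  have hK := HaarMix.five_le_oracleConst
  -- Here `33 = 3 + 6 * 5`: `D` is at most `3M/β`, and `(V D)^{2/3}`, which enters with factor `6`,
  -- is at most `5M/β`. The final `5` pays for the remainders (`4`) and the bias of level `J` (`1`).
  refine ⟨33 * HaarMix.oracleConst + 5, by linarith, ?_⟩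
  intro J hJ β hβ0 hβ
  refine ⟨HaarMix.haarEstimator_eq_haarShrinkage (by omega) β, ?_⟩
  intro x hx hx0 hx1 σ hσ Ω _ P _ ε hε hind f hf
  obtain ⟨hint, hle⟩ := HaarMix.integral_haarLoss_le hJ hβ0 hβ hx hx0 hx1 hσ hε hind hf
  refine ⟨hint, hle.trans ?_⟩
  have hN8 : (8 : ℝ) ≤ 2 ^ J := by
    calc (8 : ℝ) = 2 ^ 3 := by norm_num
      _ ≤ 2 ^ J := pow_le_pow_right₀ (by norm_num) hJ
  have hL2 := HaarMix.two_le_log hN8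
  set N : ℝ := 2 ^ J with hN
  set V := HaarMix.totalVariation f with hV
  have hV0 : 0 ≤ V := HaarMix.totalVariation_nonneg f
  have hN0 : 0 < N := by linarith
  have hβ1 : β ≤ 1 := by
    have hy : 0 < 2 * Real.log (N / 2) / N := by
      have := Real.log_pos (by linarith : 1 < N / 2)
      positivity
    linarith [(HaarMix.phiInv_mem hy).2]
  set D := (σ ^ 2 + 2 * V ^ 2 / N) * Real.log N / (N * β) with hD
  have hD0 : 0 < D := by positivity
  have hsum := HaarMix.sum_min_empInner_signal_le (by omega) hx hx0 hx1 hf hD0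
  have hrate := HaarMix.rpow_two_thirds_bound hV0 hσ (by linarith : 1 ≤ N) hβ0 hβ1
  rw [← hV] at hsum
  rw [← hD] at hrate
  set M₁ := (V * σ ^ 2 * Real.log N / N) ^ ((2 : ℝ) / 3)
  set M₂ := V ^ 2 / N with hM₂
  set M₃ := σ ^ 2 * Real.log N / N with hM₃
  set M := max M₁ (max M₂ M₃)
  have h1 : M₁ ≤ M := le_max_left _ _
  have h2 : M₂ ≤ M := (le_max_left _ _).trans (le_max_right _ _)
  have h3 : M₃ ≤ M := (le_max_right _ _).trans (le_max_right _ _)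
  have hM₂0 : 0 ≤ M₂ := by positivity
  have hM₃0 : 0 ≤ M₃ := by positivity
  have hM0 : 0 ≤ M := hM₂0.trans h2
  have hinv : 1 ≤ 1 / β := (one_le_div hβ0).2 hβ1
  have hDle : D ≤ 1 / β * (3 * M) := by
    have h4 : D = 1 / β * (M₃ + 2 * M₂ * (Real.log N / N)) := by
      rw [hD, hM₂, hM₃]
      field_simp
    have h5 : Real.log N / N ≤ 1 := by
      rw [div_le_one hN0]
      linarith [Real.log_le_sub_one_of_pos hN0]
    rw [h4]
    gcongr
    nlinarith
  have hrate' : (V * D) ^ ((2 : ℝ) / 3) ≤ 1 / β * (5 * M) := by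
    refine hrate.trans ?_
    gcongr
    linarith
  have htail : 4 * M₃ + M₂ ≤ 1 / β * (5 * M) := by
    have : 5 * M ≤ 1 / β * (5 * M) := le_mul_of_one_le_left (by positivity) hinv
    linarith
  have hmain : HaarMix.oracleConst *
      ∑ a ∈ HaarMix.haarIndex J, min D (HaarMix.empInner (HaarMix.signal f x)
        (HaarMix.haarVec J a) ^ 2) ≤ HaarMix.oracleConst * (1 / β * (33 * M)) := by
    gcongr
    refine hsum.trans ?_
    linarith
  calc _ ≤ HaarMix.oracleConst * (1 / β * (33 * M)) + 1 / β * (5 * M) := by linarith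
    _ = (33 * HaarMix.oracleConst + 5) / β * M := by ring
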